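/- Let $\mu$ be a probability measure on $\mathbb{R}$ with $\mathrm{Supp}(\mu)\subset[a,b]$, $b-a>1$ and $\{a,b\}\subset\mathrm{Supp}(\mu)$. Assume that $\mu$ is the weak limit, as $n\to\infty$, of $\frac1n\sum_{i=1}^n\delta_{x_i^{(n)}/n}$ for some integers $x_1^{(n)}>x_2^{(n)}>\cdots>x_n^{(n)}$ (so $\mu\le\lambda$, where $\lambda$ is Lebesgue measure). Let $\mathbb{H}=\{w\in\mathbb{C}:\mathrm{Im}(w)>0\}$ and $C(w)=\int_a^b\frac{\mu[dx]}{w-x}$. For $(\chi,\eta)\in[a,b]\times[0,1]$ with $b\ge\chi\ge\chi+\eta-1\ge a$ let $$f'_{(\chi,\eta)}(w)=C(w)-\int_{\chi+\eta-1}^{\chi}\frac{dx}{w-x},\qquad w\in\mathbb{C}\setminus\mathbb{R},$$ and let $\mathcal L\subset\mathbb{R}^2$ be the set of all such $(\chi,\eta)$ for which $f'_{(\chi,\eta)}$ has a non-real root. For $w\in\mathbb{H}$ put $$\chi_{\mathcal L}(w)=w+\frac{(w-\bar w)(e^{C(\bar w)}-1)}{e^{C(w)}-e^{C(\bar w)}},\qquad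 \eta_{\mathcal L}(w)=1+\frac{(w-\bar w)(e^{C(w)}-1)(e^{C(\bar w)}-1)}{e^{C(w)}-e^{C(\bar w)}}.$$ The denominator does not vanish, and $(\chi_{\mathcal L},\eta_{\mathcal L}):\mathbb{H}\to\mathcal L$ is a bijection; it is the inverse of the map that sends $(\chi,\eta)\in\mathcal L$ to the root of $f'_{(\chi,\eta)}$ in $\mathbb{H}$, which is unique. The functions $e^{C(\cdot)}$ and $C'$ on $\mathbb{C}\setminus\mathbb{R}$ have analytic extensions, denoted by the same symbols, to $\mathbb{C}\setminus\mathrm{Supp}(\mu)$ (where they are given by the integral defining $C$) and to $\mathbb{C}\setminus\mathrm{Supp}(\lambda-\mu)$. Let $R_1$ (respectively $R_2$) be the set of all $t\in\partial(\mathbb{R}\setminus\mathrm{Supp}(\mu))\cap\partial(\mathbb{R}\setminus\mathrm{Supp}(\lambda-\mu))$ for which there is an interval $I=(t_2,t_1)\ni t$ with $(t,t_1)\subset\mathbb{R}\setminus\mathrm{Supp}(\mu)$ and $(t_2,t)\subset\mathbb{R}\setminus\mathrm{Supp}(\lambda-\mu)$ (respectively $(t,t_1)\subset\mathbb{R}\setminus\mathrm{Supp}(\lambda-\mu)$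 and $(t_2,t)\subset\mathbb{R}\setminus\mathrm{Supp}(\mu)$). Let $$R=(\mathbb{R}\setminus\mathrm{Supp}(\mu))\cup(\mathbb{R}\setminus\mathrm{Supp}(\lambda-\mu))\cup R_1\cup R_2,$$ and, for an interval $I$, let $C_I(t)=\int_{[a,b]\setminus I}\frac{\mu[dx]}{t-x}$. Define $(\chi_{\mathcal E}(t),\eta_{\mathcal E}(t))$ for $t\in R$ as follows. - If $t\in(\mathbb{R}\setminus\mathrm{Supp}(\mu))\cup(\mathbb{R}\setminus\mathrm{Supp}(\lambda-\mu))$, then $$\chi_{\mathcal E}(t)=t+\frac{e^{C(t)}-1}{e^{C(t)}C'(t)},\qquad \eta_{\mathcal E}(t)=1+\frac{(e^{C(t)}-1)^2}{e^{C(t)}C'(t)};$$ here $e^{C(t)}\ne0$, $C'(t)\neq0$, and both numbers are real. - If $t\in R_1$, then $\chi_{\mathcal E}(t)=t$ and $\eta_{\mathcal E}(t)=1-e^{C_I(t)}(t-t_2)$. - If $t\in R_2$, then $\chi_{\mathcal E}(t)=t-e^{-C_I(t)}(t-t_1)$ and $\eta_{\mathcal E}(t)=1+e^{-C_I(t)}(t-t_1)$.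 In the last two cases $I=(t_2,t_1)$ is any interval as in the definition of $R_1$ or $R_2$, and the result does not depend on the choice of $I$. Then $(\chi_{\mathcal E}(t),\eta_{\mathcal E}(t))\in\partial\mathcal L$ for all $t\in R$. Moreover $(\chi_{\mathcal L}(w_n),\eta_{\mathcal L}(w_n))\to(\chi_{\mathcal E}(t),\eta_{\mathcal E}(t))$ as $n\to\infty$ for every $t\in R$ and every sequence $\{w_n\}\subset\mathbb{H}$ with $w_n\to t$. Hence the map equal to $(\chi_{\mathcal L},\eta_{\mathcal L})$ on $\mathbb{H}$ and to $(\chi_{\mathcal E},\eta_{\mathcal E})$ on $R$ is continuous on $\mathbb{H}\cup R$, and it is the only continuous extension of $(\chi_{\mathcal L},\eta_{\mathcal L})$ to $\mathbb{H}\cup R$. -/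

import Mathlib

open MeasureTheory Set Filter Topology

noncomputable section

namespace GTEdge

/-- The rescaled empirical distribution `n⁻¹ ∑ᵢ δ_{xᵢ/n}` of the `n` particles of the top row. -/
def empirical (n : ℕ) (x : Fin n → ℤ) : FiniteMeasure ℝ :=
  ((n : NNReal)⁻¹) • ∑ i, ProbabilityMeasure.toFiniteMeasure ⟨Measure.dirac ((x i : ℝ) / n), inferInstance⟩

/-- The Cauchy transform `C(w) = ∫_a^b μ[dx] / (w - x)`. -/
def cauchy (μ : Measure ℝ) (a b : ℝ) (w : ℂ) : ℂ :=
  ∫ x in Icc a b, 1 / (w - (x : ℂ)) ∂μ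

/-- `C_I(t) = ∫_{[a,b] ∖ I} μ[dx] / (t - x)` at real `t`, where `I = (t₂, t₁)`. -/
def cauchyOff (μ : Measure ℝ) (a b t₂ t₁ t : ℝ) : ℝ :=
  ∫ x in Icc a b \ Ioo t₂ t₁, 1 / (t - x) ∂μ

/-- The function `f'_{(χ,η)}(w) = ∫_a^b μ[dx]/(w-x) - ∫_{χ+η-1}^χ dx/(w-x)`, with `p = (χ,η)`. -/
def fDeriv (μ : Measure ℝ) (a b : ℝ) (p : ℝ × ℝ) (w : ℂ) : ℂ :=
  cauchy μ a b w - ∫ x in (p.1 + p.2 - 1)..p.1, 1 / (w - (x : ℂ))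

/-- The region of all `(χ,η) ∈ [a,b] × [0,1]` with `b ≥ χ ≥ χ + η - 1 ≥ a`. -/
def shape (a b : ℝ) : Set (ℝ × ℝ) :=
  {p | p ∈ Icc a b ×ˢ Icc (0 : ℝ) 1 ∧ a ≤ p.1 + p.2 - 1 ∧ p.1 + p.2 - 1 ≤ p.1 ∧ p.1 ≤ b}

/-- The liquid region `L`: those `(χ,η)` for which `f'_{(χ,η)}` has a non-real root. -/
def liquid (μ : Measure ℝ) (a b : ℝ) : Set (ℝ × ℝ) :=
  {p | p ∈ shape a b ∧ ∃ w : ℂ, w.im ≠ 0 ∧ fDeriv μ a b p w = 0}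

/-- The open upper half plane, as a subset of `ℂ`. -/
def upperHalf : Set ℂ := {w | 0 < w.im}

/-- The set `ℂ ∖ ℝ`. -/
def nonreal : Set ℂ := {w | w.im ≠ 0}

/-- The expression for `χ_L(w)`, as a complex number. -/
def chiLC (μ : Measure ℝ) (a b : ℝ) (w : ℂ) : ℂ :=
  w + (w - star w) * (Complex.exp (cauchy μ a b (star w)) - 1) /
    (Complex.exp (cauchy μ a b w) - Complex.exp (cauchy μ a b (star w)))

/-- The expression for `η_L(w)`, as a complex number. -/
def etaLC (μ : Measure ℝ) (a b : ℝ) (w : ℂ) : ℂ :=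
  1 + (w - star w) * (Complex.exp (cauchy μ a b w) - 1) *
      (Complex.exp (cauchy μ a b (star w)) - 1) /
    (Complex.exp (cauchy μ a b w) - Complex.exp (cauchy μ a b (star w)))

/-- The point `(χ_L(w), η_L(w))`. Both expressions are real for non-real `w`
when their common denominator is nonzero: see `chiL_eq`, `etaL_eq`. -/
def liquidPoint (μ : Measure ℝ) (a b : ℝ) (w : ℂ) : ℝ × ℝ :=
  ((chiLC μ a b w).re, (etaLC μ a b w).re)

theorem cauchy_star (μ : Measure ℝ) (a b : ℝ) (w : ℂ) :
    cauchy μ a b (star w) = star (cauchy μ a b w) := by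
  unfold cauchy
  have h := integral_conj (μ := μ.restrict (Icc a b)) (f := fun x : ℝ => 1 / (w - (x : ℂ)))
  simp only [starRingEnd_apply] at h
  rw [← h]
  congr 1
  funext x
  have hx : star (x : ℂ) = (x : ℂ) := Complex.conj_ofReal x
  rw [star_div₀, star_sub, star_one, hx]

theorem exp_star (z : ℂ) : Complex.exp (star z) = star (Complex.exp z) := Complex.exp_conj z

theorem chiL_eq (μ : Measure ℝ) (a b : ℝ) (w : ℂ)
    (h : Complex.exp (cauchy μ a b w) ≠ Complex.exp (cauchy μ a b (star w))) :
    ((liquidPoint μ a b w).1 : ℂ) = chiLC μ a b w := by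
  apply Complex.conj_eq_iff_re.mp
  change star (chiLC μ a b w) = chiLC μ a b w
  unfold chiLC
  rw [cauchy_star, exp_star] at *
  generalize Complex.exp (cauchy μ a b w) = e at *
  have h1 : e - star e ≠ 0 := sub_ne_zero.mpr h
  have h2 : star e - e ≠ 0 := sub_ne_zero.mpr (Ne.symm h)
  simp only [star_add, star_mul, star_sub, star_div₀, star_star, star_one]
  field_simp
  ring

theorem etaL_eq (μ : Measure ℝ) (a b : ℝ) (w : ℂ)
    (h : Complex.exp (cauchy μ a b w) ≠ Complex.exp (cauchy μ a b (star w))) :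
    ((liquidPoint μ a b w).2 : ℂ) = etaLC μ a b w := by
  apply Complex.conj_eq_iff_re.mp
  change star (etaLC μ a b w) = etaLC μ a b w
  unfold etaLC
  rw [cauchy_star, exp_star] at *
  generalize Complex.exp (cauchy μ a b w) = e at *
  have h1 : e - star e ≠ 0 := sub_ne_zero.mpr h
  have h2 : star e - e ≠ 0 := sub_ne_zero.mpr (Ne.symm h)
  simp only [star_add, star_mul, star_sub, star_div₀, star_star, star_one]
  field_simp
  ring

/-- `g` is an analytic extension of `f : ℂ ∖ ℝ → ℂ` to `ℂ ∖ S`, where `S ⊆ ℝ`. -/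
def IsAnalyticExtension (f g : ℂ → ℂ) (S : Set ℝ) : Prop :=
  AnalyticOnNhd ℂ g (((↑) : ℝ → ℂ) '' S)ᶜ ∧ EqOn g f nonreal

/-- The extension of `e^{C(·)} : ℂ ∖ ℝ → ℂ`; any continuous (in particular any analytic)
extension takes this value at every real point of its domain. -/
def expC (μ : Measure ℝ) (a b : ℝ) : ℂ → ℂ :=
  extendFrom nonreal (fun w => Complex.exp (cauchy μ a b w))

/-- The extension of `C' : ℂ ∖ ℝ → ℂ`. -/
def derivC (μ : Measure ℝ) (a b : ℝ) : ℂ → ℂ :=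
  extendFrom nonreal (deriv (cauchy μ a b))

/-- `ℝ ∖ Supp(μ)`. -/
def voidSet (μ : Measure ℝ) : Set ℝ := (μ.support)ᶜ

/-- `ℝ ∖ Supp(λ - μ)`. -/
def satSet (μ : Measure ℝ) : Set ℝ := ((volume - μ).support)ᶜ

/-- `I = (t₂, t₁)` contains `t`, with `(t,t₁)` outside `Supp(μ)` and `(t₂,t)` outside
`Supp(λ - μ)`. -/
def IsInterval1 (μ : Measure ℝ) (t t₂ t₁ : ℝ) : Prop :=
  t ∈ Ioo t₂ t₁ ∧ Ioo t t₁ ⊆ voidSet μ ∧ Ioo t₂ t ⊆ satSet μ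

/-- `I = (t₂, t₁)` contains `t`, with `(t,t₁)` outside `Supp(λ - μ)` and `(t₂,t)` outside
`Supp(μ)`. -/
def IsInterval2 (μ : Measure ℝ) (t t₂ t₁ : ℝ) : Prop :=
  t ∈ Ioo t₂ t₁ ∧ Ioo t t₁ ⊆ satSet μ ∧ Ioo t₂ t ⊆ voidSet μ

/-- The set `R₁`. -/
def R1 (μ : Measure ℝ) : Set ℝ :=
  {t | t ∈ frontier (voidSet μ) ∩ frontier (satSet μ) ∧ ∃ I : ℝ × ℝ, IsInterval1 μ t I.1 I.2}

/-- The set `R₂`. -/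
def R2 (μ : Measure ℝ) : Set ℝ :=
  {t | t ∈ frontier (voidSet μ) ∩ frontier (satSet μ) ∧ ∃ I : ℝ × ℝ, IsInterval2 μ t I.1 I.2}

/-- The parameter set `R` of the edge curve. -/
def R (μ : Measure ℝ) : Set ℝ := voidSet μ ∪ satSet μ ∪ R1 μ ∪ R2 μ

/-- The right side of the formula for `χ_E(t)`, for `t` outside `Supp(μ)` or `Supp(λ - μ)`. -/
def chiEC (μ : Measure ℝ) (a b t : ℝ) : ℂ :=
  t + (expC μ a b t - 1) / (expC μ a b t * derivC μ a b t)

/-- The right side of the formula for `η_E(t)`, for `t` outside `Supp(μ)` or `Supp(λ - μ)`. -/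
def etaEC (μ : Measure ℝ) (a b t : ℝ) : ℂ :=
  1 + (expC μ a b t - 1) ^ 2 / (expC μ a b t * derivC μ a b t)

open Classical in
/-- The edge point `(χ_E(t), η_E(t))` for `t ∈ R`; the value `(0, 0)` is taken off `R`. For
`t ∈ R₁ ∪ R₂` some admissible interval `I = (t₂, t₁)` is chosen. -/
def edgePoint (μ : Measure ℝ) (a b t : ℝ) : ℝ × ℝ :=
  if t ∈ voidSet μ ∪ satSet μ then ((chiEC μ a b t).re, (etaEC μ a b t).re)
  else if h : t ∈ R1 μ then
    (t, 1 - Real.exp (cauchyOff μ a b h.2.choose.1 h.2.choose.2 t) * (t - h.2.choose.1))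
  else if h : t ∈ R2 μ then
    (t - Real.exp (-cauchyOff μ a b h.2.choose.1 h.2.choose.2 t) * (t - h.2.choose.2),
      1 + Real.exp (-cauchyOff μ a b h.2.choose.1 h.2.choose.2 t) * (t - h.2.choose.2))
  else (0, 0)

/-- The half plane together with the parameter set `R ⊆ ℝ`. -/
def halfPlaneWithR (μ : Measure ℝ) : Set ℂ := upperHalf ∪ ((↑) : ℝ → ℂ) '' R μ

open Classical in
/-- `(χ_L, η_L)` on the upper half plane, `(χ_E, η_E)` on the real axis. -/
def extendedMap (μ : Measure ℝ) (a b : ℝ) (w : ℂ) : ℝ × ℝ :=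
  if w ∈ upperHalf then liquidPoint μ a b w else edgePoint μ a b w.re

end GTEdge

end

noncomputable section

namespace GTEdge

/-! Distinct integers have spacing at least one, so the weak limit satisfies `μ ≤ λ`. Comparing with
Lebesgue measure on `[a,b]` then puts `Im C(w)` in `(-π, 0)` for `w` in the upper half plane. Hence
`Im e^{C(w)} < 0` and the denominator in the formulas is nonzero.

Put `c = χ + η - 1` and `d = χ`. Exponentiating `f'(w) = 0` gives `e^{C(w)} (w - d) = w - c`. Since
`c` and `d` are real, this equation and its conjugate form a linear system whose only solution is
`(χ_L(w), η_L(w))`. Conversely, that solution has `η < 1`, so both logarithms lie in the strip where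
`exp` is injective, and `w` is a root.

The remaining global facts come from testing the signed measure `μ - λ|_[c,d]`, which is nonpositive
on `[c,d]` and nonnegative off it. A root `w` makes it annihilate every `(αx + β)/|w - x|²`. Test
functions whose sign matches the measure therefore confine `(c,d)` to the admissible region. Given
two roots `w ≠ z` in the half plane, it also annihilates `(x - c)(x - d)/(|w - x|² |z - x|²)`, by
partial fractions. But that integral is positive, because `d - c ≤ 1 < b - a` leaves `μ` some mass
outside `[c,d]`. This gives injectivity. The version for sequences, `not_tendsto_liquidPoint`, also
shows that a limit of `(χ_L, η_L)` at a real point is never a point of `L`. Such a limit is in the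
closure of `L`, hence in its boundary.

Near a point of `R`, `μ` is Lebesgue measure on a subinterval `(c,d)`, possibly empty, of a
neighbourhood `I`. So `e^C = e^{C_I} (w - c)/(w - d)` there, which extends meromorphically across
the real line. The ratio `(e^{C(w)} - e^{C(w̄)})/(w - w̄)` is a slope between two points tending to
`t`, so it converges by strict differentiability where `e^C` is analytic (including its zero on
`R₂`). The simple pole on `R₁` is factored out first. All edge formulas are limits of one function,
so uniqueness of limits gives independence of the choice of `I`. -/

/-! ### The limit measure is dominated by Lebesgue measure. -/

theorem empirical_apply (n : ℕ) (x : Fin n → ℤ) (s : Set ℝ) (hs : MeasurableSet s) :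
    (empirical n x : Measure ℝ) s =
      (n : ENNReal)⁻¹ * ∑ i, s.indicator 1 ((x i : ℝ) / n) := by
  unfold empirical
  rcases Nat.eq_zero_or_pos n with rfl | hn
  · simp
  rw [FiniteMeasure.toMeasure_smul, FiniteMeasure.toMeasure_sum]
  simp only [Measure.smul_apply, Measure.coe_finsetSum, Finset.sum_apply]
  have : ∀ i : Fin n, ((ProbabilityMeasure.toFiniteMeasure
      ⟨Measure.dirac ((x i : ℝ) / n), inferInstance⟩ : FiniteMeasure ℝ) : Measure ℝ) s
      = s.indicator 1 ((x i : ℝ) / n) := by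
    intro i
    exact Measure.dirac_apply' _ hs
  simp only [this]
  rw [ENNReal.smul_def, smul_eq_mul]
  congr 1
  rw [ENNReal.coe_inv (by positivity)]
  simp

theorem empirical_mass {n : ℕ} (hn : 0 < n) (x : Fin n → ℤ) : (empirical n x).mass = 1 := by
  have h := empirical_apply n x univ MeasurableSet.univ
  simp only [indicator_univ, Pi.one_apply, Finset.sum_const, Finset.card_univ, Fintype.card_fin,
    nsmul_eq_mul, mul_one] at h
  rw [ENNReal.inv_mul_cancel (by simpa using hn.ne') (by simp)] at h
  have h2 : ((empirical n x).mass : ENNReal) = 1 := by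
    rw [FiniteMeasure.ennreal_mass, h]
  exact_mod_cast h2

theorem normalize_eq_of_mass_one (m : FiniteMeasure ℝ) (h : m.mass = 1) :
    (m.normalize : Measure ℝ) = m := by
  have := m.self_eq_mass_smul_normalize
  rw [h, one_smul] at this
  conv_rhs => rw [this]
  rfl

/-- The `xᵢ` are distinct integers, so those with `xᵢ/n` in the interval are at most as many as the
integers in `(nc, nd)`. The `1/n` is the rounding error. -/
theorem empirical_Ioo_le {n : ℕ} (hn : 0 < n) (x : Fin n → ℤ) (hx : StrictAnti x) {c d : ℝ}
    (hcd : c < d) :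
    (empirical n x : Measure ℝ) (Ioo c d) ≤ ENNReal.ofReal (d - c + 1 / n) := by
  have hn' : (0 : ℝ) < n := by exact_mod_cast hn
  rw [empirical_apply n x _ measurableSet_Ioo]
  have hcard : (∑ i, (Ioo c d).indicator (1 : ℝ → ENNReal) ((x i : ℝ) / n)) =
      ((Finset.univ.filter fun i => (x i : ℝ) / n ∈ Ioo c d).card : ENNReal) := by
    classical
    rw [Finset.card_filter]
    push_cast
    refine Finset.sum_congr rfl fun i _ => ?_
    by_cases h : (x i : ℝ) / n ∈ Ioo c d <;> simp [h]
  rw [hcard]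
  set k := (Finset.univ.filter fun i => (x i : ℝ) / n ∈ Ioo c d).card with hk
  have hk1 : k ≤ (Finset.Ioo ⌊n * c⌋ ⌈n * d⌉).card := by
    refine Finset.card_le_card_of_injOn x ?_ (hx.injective.injOn)
    intro i hi
    simp only [Finset.coe_filter, Finset.mem_univ, true_and, mem_ofPred_eq, mem_Ioo] at hi
    rw [lt_div_iff₀ hn', div_lt_iff₀ hn'] at hi
    simp only [Finset.coe_Ioo, mem_Ioo]
    exact ⟨Int.floor_lt.2 (by linarith), Int.lt_ceil.2 (by linarith)⟩
  have hk2 : (k : ℝ) ≤ n * (d - c) + 1 := by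
    rw [Int.card_Ioo] at hk1
    have h1 : (k : ℤ) ≤ max (⌈(n : ℝ) * d⌉ - ⌊(n : ℝ) * c⌋ - 1) 0 := by
      rw [← Int.toNat_eq_max]; exact_mod_cast hk1
    have h2 : (k : ℝ) ≤ max ((⌈(n : ℝ) * d⌉ : ℝ) - ⌊(n : ℝ) * c⌋ - 1) 0 := by exact_mod_cast h1
    refine h2.trans (max_le ?_ ?_)
    · have := Int.ceil_lt_add_one ((n : ℝ) * d)
      have := Int.sub_one_lt_floor ((n : ℝ) * c)
      linarith
    · have := mul_pos hn' (sub_pos.2 hcd)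
      linarith
  calc (n : ENNReal)⁻¹ * k = ENNReal.ofReal ((n : ℝ)⁻¹ * k) := by
        rw [ENNReal.ofReal_mul (by positivity), ENNReal.ofReal_inv_of_pos hn']
        simp
    _ ≤ _ := by
        apply ENNReal.ofReal_le_ofReal
        rw [inv_mul_le_iff₀ hn']
        have : (n : ℝ) * (d - c + 1 / n) = n * (d - c) + 1 := by field_simp
        linarith

/-- The portmanteau inequality for open sets passes the counting bound to the limit. It is applied
to normalized measures, which changes nothing when the mass is one. -/
theorem measure_Ioo_le_of_tendsto (μ : Measure ℝ) [IsProbabilityMeasure μ]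
    (x : (n : ℕ) → Fin n → ℤ) (hx : ∀ n, StrictAnti (x n))
    (hlim : Tendsto (fun n => empirical n (x n)) atTop
      (𝓝 (⟨μ, inferInstance⟩ : FiniteMeasure ℝ))) {c d : ℝ} (hcd : c < d) :
    μ (Ioo c d) ≤ ENNReal.ofReal (d - c) := by
  obtain ⟨M, hM⟩ : ∃ M : FiniteMeasure ℝ, M = ⟨μ, inferInstance⟩ := ⟨_, rfl⟩
  have hMμ : (M : Measure ℝ) = μ := by rw [hM]; rfl
  rw [← hM] at hlim
  have hm : M.mass = 1 := by
    have : (M.mass : ENNReal) = 1 := by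
      rw [FiniteMeasure.ennreal_mass, hMμ]; exact measure_univ
    exact_mod_cast this
  have hne : M ≠ 0 := by
    rintro rfl; simp at hm
  have h1 := FiniteMeasure.tendsto_normalize_of_tendsto hlim hne
  have h2 := ProbabilityMeasure.le_liminf_measure_open_of_tendsto h1 (isOpen_Ioo (a := c) (b := d))
  rw [normalize_eq_of_mass_one _ hm, hMμ] at h2
  refine h2.trans ?_
  have h3 : Tendsto (fun n : ℕ => ENNReal.ofReal (d - c + 1 / n)) atTop
      (𝓝 (ENNReal.ofReal (d - c))) := by
    refine (ENNReal.continuous_ofReal.tendsto _).comp ?_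
    simpa using (tendsto_const_nhds (x := d - c)).add (tendsto_one_div_atTop_nhds_zero_nat (𝕜 := ℝ))
  rw [← h3.liminf_eq]
  refine liminf_le_liminf ?_
  -- The empty row `n = 0` has mass zero and must be excluded.
  filter_upwards [eventually_gt_atTop 0] with n hn
  rw [normalize_eq_of_mass_one _ (empirical_mass hn _)]
  exact empirical_Ioo_le hn (x n) (hx n) hcd

theorem le_volume_of_Ioo (μ : Measure ℝ) [IsProbabilityMeasure μ]
    (h : ∀ c d : ℝ, c < d → μ (Ioo c d) ≤ ENNReal.ofReal (d - c)) : μ ≤ volume := by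
  have hIoc : ∀ c d : ℝ, c ≤ d → μ (Ioc c d) ≤ ENNReal.ofReal (d - c) := by
    intro c d hcd
    have h3 : Tendsto (fun n : ℕ => ENNReal.ofReal (d + 1 / ((n : ℝ) + 1) - c)) atTop
        (𝓝 (ENNReal.ofReal (d - c))) := by
      refine (ENNReal.continuous_ofReal.tendsto _).comp ?_
      simpa using ((tendsto_const_nhds (x := d)).add
        (tendsto_one_div_add_atTop_nhds_zero_nat (𝕜 := ℝ))).sub_const c
    refine ge_of_tendsto' h3 fun n => ?_
    have hp : (0 : ℝ) < 1 / ((n : ℝ) + 1) := by positivity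
    refine le_trans (measure_mono ?_) (h c (d + 1 / ((n : ℝ) + 1)) (by linarith))
    intro y hy
    exact ⟨hy.1, by linarith [hy.2]⟩
  -- With `F` the distribution function of `μ`, the bound on intervals says that `y - F(y)` is
  -- monotone. Its Stieltjes measure is then the complement of `μ` in Lebesgue measure.
  let g : StieltjesFunction ℝ :=
    { toFun := fun y => y - ProbabilityTheory.cdf μ y
      mono' := by
        intro y z hyz
        have h1 := hIoc y z hyz
        rw [← ProbabilityTheory.measure_cdf μ, StieltjesFunction.measure_Ioc] at h1
        have := (ENNReal.ofReal_le_ofReal_iff (sub_nonneg.2 hyz)).1 h1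
        change y - _ ≤ z - _
        linarith
      right_continuous' := fun y =>
        continuousWithinAt_id.sub ((ProbabilityTheory.cdf μ).right_continuous y) }
  have h2 : g + ProbabilityTheory.cdf μ = StieltjesFunction.id := by
    ext y
    change (y - ProbabilityTheory.cdf μ y) + ProbabilityTheory.cdf μ y = y
    ring
  have h3 : g.measure + μ = volume := by
    conv_lhs => rw [← ProbabilityTheory.measure_cdf μ]
    rw [← StieltjesFunction.measure_add, h2]
    exact Real.volume_eq_stieltjes_id.symm
  rw [← h3]
  exact Measure.le_add_left le_rfl

theorem le_volume_of_tendsto (μ : Measure ℝ) [IsProbabilityMeasure μ]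
    (x : (n : ℕ) → Fin n → ℤ) (hx : ∀ n, StrictAnti (x n))
    (hlim : Tendsto (fun n => empirical n (x n)) atTop
      (𝓝 (⟨μ, inferInstance⟩ : FiniteMeasure ℝ))) : μ ≤ volume :=
  le_volume_of_Ioo μ fun _ _ => measure_Ioo_le_of_tendsto μ x hx hlim

theorem measure_compl_Icc_eq_zero {μ : Measure ℝ} {a b : ℝ} (hsupp : μ.support ⊆ Icc a b) :
    μ (Icc a b)ᶜ = 0 :=
  measure_mono_null (compl_subset_compl.2 hsupp) Measure.measure_compl_support

theorem measure_eq_zero_of_subset_voidSet {μ : Measure ℝ} {s : Set ℝ} (hs : s ⊆ voidSet μ) :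
    μ s = 0 :=
  measure_mono_null hs Measure.measure_compl_support

/-- Because `μ ≤ λ`, one has `λ = (λ - μ) + μ`, and the first summand vanishes on `s`. -/
theorem restrict_eq_of_subset_satSet {μ : Measure ℝ} [IsFiniteMeasure μ] (hle : μ ≤ volume)
    {s : Set ℝ} (hs : s ⊆ satSet μ) : μ.restrict s = volume.restrict s := by
  have h0 : ((volume : Measure ℝ) - μ) s = 0 := measure_mono_null hs Measure.measure_compl_support
  conv_rhs => rw [← Measure.sub_add_cancel_of_le hle]
  rw [Measure.restrict_add, Measure.restrict_eq_zero.2 h0, zero_add]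

/-! ### Analyticity of Cauchy transforms and bounds on their imaginary part. -/

/-- The Cauchy transform of the restriction of `μ` to `S`. -/
def cauchyOn (μ : Measure ℝ) (S : Set ℝ) (w : ℂ) : ℂ := ∫ x in S, 1 / (w - (x : ℂ)) ∂μ

theorem isOpen_compl_ofReal_image {K : Set ℝ} (hK : IsClosed K) :
    IsOpen (((↑) : ℝ → ℂ) '' K)ᶜ :=
  (Complex.isometry_ofReal.isClosedEmbedding.isClosedMap _ hK).isOpen_compl

theorem exists_kernel_lower_bound {K : Set ℝ} (hK : IsClosed K) {w₀ : ℂ}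
    (hw : w₀ ∈ (((↑) : ℝ → ℂ) '' K)ᶜ) :
    ∃ δ > 0, ∀ w ∈ Metric.ball w₀ δ, ∀ x ∈ K, δ ≤ ‖w - (x : ℂ)‖ := by
  obtain ⟨ε, hε, hsub⟩ := Metric.isOpen_iff.1 (isOpen_compl_ofReal_image hK) w₀ hw
  refine ⟨ε / 2, by positivity, fun w hw x hx => ?_⟩
  by_contra! hlt
  refine hsub (a := (x : ℂ)) ?_ ⟨x, hx, rfl⟩
  rw [Metric.mem_ball, dist_comm, dist_eq_norm]
  rw [Metric.mem_ball, dist_comm, dist_eq_norm] at hw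
  calc ‖w₀ - x‖ = ‖(w₀ - w) + (w - x)‖ := by ring_nf
    _ ≤ ‖w₀ - w‖ + ‖w - x‖ := norm_add_le _ _
    _ < ε := by linarith

theorem measurable_kernel (w : ℂ) : Measurable fun x : ℝ => 1 / (w - (x : ℂ)) := by
  fun_prop

theorem integrable_kernel {m : Measure ℝ} [IsFiniteMeasure m] {K : Set ℝ} (hK : IsClosed K)
    (hm : ∀ᵐ x ∂m, x ∈ K) {w₀ : ℂ} (hw : w₀ ∈ (((↑) : ℝ → ℂ) '' K)ᶜ) :
    Integrable (fun x : ℝ => 1 / (w₀ - (x : ℂ))) m := by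
  obtain ⟨δ, hδ, hb⟩ := exists_kernel_lower_bound hK hw
  refine Integrable.of_bound (measurable_kernel w₀).aestronglyMeasurable (1 / δ) ?_
  filter_upwards [hm] with x hx
  rw [norm_div, norm_one]
  exact one_div_le_one_div_of_le hδ (hb w₀ (Metric.mem_ball_self hδ) x hx)

theorem hasDerivAt_integral_kernel {m : Measure ℝ} [IsFiniteMeasure m] {K : Set ℝ}
    (hK : IsClosed K) (hm : ∀ᵐ x ∂m, x ∈ K) {w₀ : ℂ} (hw : w₀ ∈ (((↑) : ℝ → ℂ) '' K)ᶜ) :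
    HasDerivAt (fun w : ℂ => ∫ x : ℝ, 1 / (w - (x : ℂ)) ∂m)
      (∫ x : ℝ, -1 / (w₀ - (x : ℂ)) ^ 2 ∂m) w₀ := by
  obtain ⟨δ, hδ, hb⟩ := exists_kernel_lower_bound hK hw
  refine (hasDerivAt_integral_of_dominated_loc_of_deriv_le (bound := fun _ => 1 / δ ^ 2)
    (F := fun (w : ℂ) (x : ℝ) => 1 / (w - (x : ℂ)))
    (F' := fun (w : ℂ) (x : ℝ) => -1 / (w - (x : ℂ)) ^ 2)
    (Metric.ball_mem_nhds w₀ hδ) ?_ ?_ ?_ ?_ (integrable_const _) ?_).2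
  · exact Eventually.of_forall fun w => (measurable_kernel w).aestronglyMeasurable
  · exact integrable_kernel hK hm hw
  · exact (by fun_prop : Measurable fun x : ℝ => -1 / (w₀ - (x : ℂ)) ^ 2).aestronglyMeasurable
  · filter_upwards [hm] with x hx w hw
    rw [norm_div, norm_neg, norm_one, norm_pow]
    have := hb w hw x hx
    gcongr
  · filter_upwards [hm] with x hx w hw
    have h1 : w - (x : ℂ) ≠ 0 := by
      rw [← norm_pos_iff]; exact hδ.trans_le (hb w hw x hx)
    simpa [one_div] using ((hasDerivAt_id w).sub_const (x : ℂ)).fun_inv h1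

theorem hasDerivAt_cauchyOn {μ : Measure ℝ} [IsFiniteMeasure μ] {S K : Set ℝ}
    (hK : IsClosed K) (hS : μ (S \ K) = 0) (hSm : MeasurableSet S) {w₀ : ℂ}
    (hw : w₀ ∈ (((↑) : ℝ → ℂ) '' K)ᶜ) :
    HasDerivAt (cauchyOn μ S) (∫ x in S, -1 / (w₀ - (x : ℂ)) ^ 2 ∂μ) w₀ := by
  refine hasDerivAt_integral_kernel hK ?_ hw
  rw [ae_restrict_iff' hSm, ae_iff]
  refine measure_mono_null (fun x hx => ?_) hS
  simpa [Classical.not_imp] using hx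

theorem analyticAt_cauchyOn {μ : Measure ℝ} [IsFiniteMeasure μ] {S K : Set ℝ}
    (hK : IsClosed K) (hS : μ (S \ K) = 0) (hSm : MeasurableSet S) {w₀ : ℂ}
    (hw : w₀ ∈ (((↑) : ℝ → ℂ) '' K)ᶜ) : AnalyticAt ℂ (cauchyOn μ S) w₀ := by
  refine DifferentiableOn.analyticAt (s := (((↑) : ℝ → ℂ) '' K)ᶜ) ?_
    ((isOpen_compl_ofReal_image hK).mem_nhds hw)
  exact fun w hw => (hasDerivAt_cauchyOn hK hS hSm hw).differentiableAt.differentiableWithinAt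

theorem mem_compl_ofReal_image_of_nonreal {w : ℂ} (hw : w ∈ nonreal) (K : Set ℝ) :
    w ∈ (((↑) : ℝ → ℂ) '' K)ᶜ := by
  rintro ⟨x, _, rfl⟩
  exact hw (Complex.ofReal_im x)

theorem isOpen_nonreal : IsOpen nonreal := isOpen_ne_fun Complex.continuous_im continuous_const

theorem upperHalf_subset_nonreal : upperHalf ⊆ nonreal := fun _ hw => ne_of_gt hw

theorem star_mem_nonreal {w : ℂ} (hw : w ∈ nonreal) : star w ∈ nonreal := by
  have : (star w).im = -w.im := Complex.conj_im w
  change (star w).im ≠ 0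
  rw [this]; exact neg_ne_zero.2 hw

theorem sub_ofReal_ne_zero {w : ℂ} (hw : w ∈ nonreal) (x : ℝ) : w - (x : ℂ) ≠ 0 := by
  intro h
  apply hw
  rw [sub_eq_zero.1 h, Complex.ofReal_im]

theorem analyticAt_cauchy {μ : Measure ℝ} [IsFiniteMeasure μ] {a b : ℝ} {w : ℂ}
    (hw : w ∈ nonreal) : AnalyticAt ℂ (cauchy μ a b) w :=
  analyticAt_cauchyOn (S := Icc a b) (K := univ) isClosed_univ (by simp) measurableSet_Icc
    (mem_compl_ofReal_image_of_nonreal hw _)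

theorem continuous_kernel {w : ℂ} (hw : w ∈ nonreal) :
    Continuous fun x : ℝ => 1 / (w - (x : ℂ)) :=
  continuous_const.div (by fun_prop) (sub_ofReal_ne_zero hw)

theorem intervalIntegral_kernel {w : ℂ} (hw : w ∈ nonreal) (c d : ℝ) :
    ∫ x in c..d, 1 / (w - (x : ℂ)) = Complex.log (w - c) - Complex.log (w - d) := by
  have h : ∀ x ∈ uIcc c d, HasDerivAt (fun x : ℝ => -Complex.log (w - (x : ℂ)))
      (1 / (w - (x : ℂ))) x := by
    intro x _
    have h1 : HasDerivAt (fun x : ℝ => w - (x : ℂ)) (-1) x :=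
      (Complex.ofRealCLM.hasDerivAt (x := x)).const_sub w
    have h2 : w - (x : ℂ) ∈ Complex.slitPlane := by
      refine Or.inr ?_
      simpa using (show w.im ≠ 0 from hw)
    simpa [neg_div] using (h1.clog_real h2).fun_neg
  rw [intervalIntegral.integral_eq_sub_of_hasDerivAt h
    ((continuous_kernel hw).intervalIntegrable _ _)]
  ring

theorem exp_intervalIntegral_kernel {w : ℂ} (hw : w ∈ nonreal) (c d : ℝ) :
    Complex.exp (∫ x in c..d, 1 / (w - (x : ℂ))) = (w - c) / (w - d) := by
  rw [intervalIntegral_kernel hw, Complex.exp_sub, Complex.exp_log (sub_ofReal_ne_zero hw c),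
    Complex.exp_log (sub_ofReal_ne_zero hw d)]

theorem kernel_im (w : ℂ) (x : ℝ) :
    (1 / (w - (x : ℂ))).im = -(w.im / Complex.normSq (w - x)) := by
  rw [one_div, Complex.inv_im]
  simp [neg_div]

theorem neg_kernel_im_pos {w : ℂ} (hw : w ∈ upperHalf) (x : ℝ) :
    0 < -(1 / (w - (x : ℂ))).im := by
  rw [kernel_im, neg_neg]
  exact div_pos hw (Complex.normSq_pos.2 (sub_ofReal_ne_zero (upperHalf_subset_nonreal hw) x))

/-- The imaginary part is a difference of two arguments of points of the upper half plane. The lower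
bound is strict because neither argument reaches `π`. -/
theorem intervalIntegral_kernel_im_bounds {w : ℂ} (hw : w ∈ upperHalf) {c d : ℝ} (hcd : c ≤ d) :
    -Real.pi < (∫ x in c..d, 1 / (w - (x : ℂ))).im ∧
      (∫ x in c..d, 1 / (w - (x : ℂ))).im ≤ 0 := by
  have hn := upperHalf_subset_nonreal hw
  constructor
  · rw [intervalIntegral_kernel hn, Complex.sub_im, Complex.log_im, Complex.log_im]
    have h1 : 0 ≤ Complex.arg (w - c) := by
      rw [Complex.arg_nonneg_iff]; simpa using le_of_lt hw
    have h2 : Complex.arg (w - d) < Real.pi := by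
      refine lt_of_le_of_ne (Complex.arg_le_pi _) fun h => ?_
      rw [Complex.arg_eq_pi_iff] at h
      exact hn (by simpa using h.2)
    linarith
  · have h1 : (∫ x in c..d, 1 / (w - (x : ℂ))).im = ∫ x in c..d, (1 / (w - (x : ℂ))).im := by
      have := Complex.imCLM.intervalIntegral_comp_comm
        ((continuous_kernel hn).intervalIntegrable (μ := volume) c d)
      exact this.symm
    rw [h1]
    have h2 : 0 ≤ ∫ x in c..d, -(1 / (w - (x : ℂ))).im :=
      intervalIntegral.integral_nonneg hcd fun x _ => (neg_kernel_im_pos hw x).le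
    rw [intervalIntegral.integral_neg] at h2
    linarith

theorem integrableOn_Icc_of_continuous {E : Type*} [NormedAddCommGroup E] {m : Measure ℝ}
    [IsLocallyFiniteMeasure m] {f : ℝ → E} (hf : Continuous f) (a b : ℝ) :
    IntegrableOn f (Icc a b) m :=
  hf.continuousOn.integrableOn_compact isCompact_Icc

/-- The integrand `-Im 1/(w - x)` is positive, so `μ ≤ λ` bounds its integral by that over `[a,b]`
with Lebesgue measure, which is below `π`. The total mass one makes the integral positive. -/
theorem cauchy_im_bounds {μ : Measure ℝ} [IsProbabilityMeasure μ] {a b : ℝ} (hle : μ ≤ volume)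
    (hc : μ (Icc a b)ᶜ = 0) (hab : a ≤ b) {w : ℂ} (hw : w ∈ upperHalf) :
    -Real.pi < (cauchy μ a b w).im ∧ (cauchy μ a b w).im < 0 := by
  have hn := upperHalf_subset_nonreal hw
  have hcont : Continuous fun x : ℝ => -(1 / (w - (x : ℂ))).im :=
    (Complex.continuous_im.comp (continuous_kernel hn)).neg
  have him : ∀ m : Measure ℝ, IsLocallyFiniteMeasure m → (∫ x in Icc a b, 1 / (w - (x : ℂ)) ∂m).im =
      -∫ x in Icc a b, -(1 / (w - (x : ℂ))).im ∂m := by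
    intro m _
    rw [integral_neg, neg_neg]
    exact (Complex.imCLM.integral_comp_comm
      (integrableOn_Icc_of_continuous (m := m) (continuous_kernel hn) a b)).symm
  constructor
  · have h1 : ∫ x in Icc a b, -(1 / (w - (x : ℂ))).im ∂μ ≤
        ∫ x in Icc a b, -(1 / (w - (x : ℂ))).im :=
      integral_mono_measure (Measure.restrict_mono le_rfl hle)
        (Eventually.of_forall fun x => (neg_kernel_im_pos hw x).le)
        (integrableOn_Icc_of_continuous hcont a b)
    have h2 := (intervalIntegral_kernel_im_bounds hw hab).1
    rw [intervalIntegral.integral_of_le hab, ← integral_Icc_eq_integral_Ioc,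
      him volume inferInstance] at h2
    unfold cauchy
    rw [him μ inferInstance]
    linarith
  · unfold cauchy
    rw [him μ inferInstance, neg_lt_zero,
      integral_pos_iff_support_of_nonneg (fun x => (neg_kernel_im_pos hw x).le)
        (integrableOn_Icc_of_continuous hcont a b)]
    have : (Function.support fun x : ℝ => -(1 / (w - (x : ℂ))).im) = univ := by
      ext x
      simpa using (neg_kernel_im_pos hw x).ne'
    rw [this, Measure.restrict_apply_univ, (prob_compl_eq_zero_iff measurableSet_Icc).1 hc]
    exact one_pos

theorem exp_cauchy_im_neg {μ : Measure ℝ} [IsProbabilityMeasure μ] {a b : ℝ} (hle : μ ≤ volume)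
    (hc : μ (Icc a b)ᶜ = 0) (hab : a ≤ b) {w : ℂ} (hw : w ∈ upperHalf) :
    (Complex.exp (cauchy μ a b w)).im < 0 := by
  obtain ⟨h1, h2⟩ := cauchy_im_bounds hle hc hab hw
  rw [Complex.exp_im]
  exact mul_neg_of_pos_of_neg (Real.exp_pos _) (Real.sin_neg_of_neg_of_neg_pi_lt h2 h1)

/-! ### The signed measure `μ|_[a,b] - λ|_[c,d]` and its sign. -/

section Charge

variable {E : Type*} [NormedAddCommGroup E] [NormedSpace ℝ E]

/-- The integral of `f` against the signed measure `μ|_[a,b] - λ|_[c,d]`. -/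
def charge (μ : Measure ℝ) (a b c d : ℝ) (f : ℝ → E) : E :=
  ∫ x in Icc a b, f x ∂μ - ∫ x in c..d, f x

variable {μ : Measure ℝ} {a b c d : ℝ}

theorem charge_add [IsFiniteMeasure μ] {f g : ℝ → E} (hf : Continuous f) (hg : Continuous g) :
    charge μ a b c d (fun x => f x + g x) = charge μ a b c d f + charge μ a b c d g := by
  unfold charge
  rw [integral_add (integrableOn_Icc_of_continuous hf a b) (integrableOn_Icc_of_continuous hg a b),
    intervalIntegral.integral_add (hf.intervalIntegrable _ _) (hg.intervalIntegrable _ _)]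
  abel

theorem charge_sub [IsFiniteMeasure μ] {f g : ℝ → E} (hf : Continuous f) (hg : Continuous g) :
    charge μ a b c d (fun x => f x - g x) = charge μ a b c d f - charge μ a b c d g := by
  unfold charge
  rw [integral_sub (integrableOn_Icc_of_continuous hf a b) (integrableOn_Icc_of_continuous hg a b),
    intervalIntegral.integral_sub (hf.intervalIntegrable _ _) (hg.intervalIntegrable _ _)]
  abel

theorem charge_const_mul {𝕜 : Type*} [RCLike 𝕜] (r : 𝕜) (f : ℝ → 𝕜) :
    charge μ a b c d (fun x => r * f x) = r * charge μ a b c d f := by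
  unfold charge
  rw [integral_const_mul, intervalIntegral.integral_const_mul]
  ring

theorem charge_ofReal (f : ℝ → ℝ) :
    charge μ a b c d (fun x => (f x : ℂ)) = ((charge μ a b c d f : ℝ) : ℂ) := by
  unfold charge
  have h1 : ∫ x in Icc a b, (f x : ℂ) ∂μ = ((∫ x in Icc a b, f x ∂μ : ℝ) : ℂ) := integral_ofReal
  rw [h1, intervalIntegral.integral_ofReal]
  push_cast
  rfl

theorem integral_kernel_star (m : Measure ℝ) (w : ℂ) :
    ∫ x : ℝ, 1 / (star w - (x : ℂ)) ∂m = star (∫ x : ℝ, 1 / (w - (x : ℂ)) ∂m) := by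
  have h := integral_conj (μ := m) (f := fun x : ℝ => 1 / (w - (x : ℂ)))
  simp only [starRingEnd_apply] at h
  rw [← h]
  congr 1
  funext x
  have hx : star (x : ℂ) = (x : ℂ) := Complex.conj_ofReal x
  rw [star_div₀, star_sub, star_one, hx]

theorem charge_kernel_star (w : ℂ) :
    charge μ a b c d (fun x : ℝ => 1 / (star w - (x : ℂ))) =
      star (charge μ a b c d (fun x : ℝ => 1 / (w - (x : ℂ)))) := by
  unfold charge intervalIntegral
  simp only [integral_kernel_star, star_sub]

theorem continuous_charge [CompleteSpace E] {f : ℝ → E} (hf : Continuous f) :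
    Continuous fun p : ℝ × ℝ => charge μ a b p.1 p.2 f := by
  have hi : ∀ u v : ℝ, IntervalIntegrable f volume u v := fun u v => hf.intervalIntegrable u v
  have h : (fun p : ℝ × ℝ => charge μ a b p.1 p.2 f) = fun p : ℝ × ℝ =>
      ∫ x in Icc a b, f x ∂μ - ((∫ x in (0 : ℝ)..p.2, f x) - ∫ x in (0 : ℝ)..p.1, f x) := by
    funext p
    rw [charge, intervalIntegral.integral_interval_sub_left (hi _ _) (hi _ _)]
  rw [h]
  have hp := intervalIntegral.continuous_primitive hi 0
  exact continuous_const.sub ((hp.comp continuous_snd).sub (hp.comp continuous_fst))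

/-- The part of the charge dropped here is the integral of `-φ ≥ 0` over `[a,b] ∩ [c,d]` against `λ
- μ`, which is nonnegative. The two remaining terms are kept separate because either one can supply
strict positivity. -/
theorem charge_ge [IsFiniteMeasure μ] {φ : ℝ → ℝ} (hle : μ ≤ volume) (hφ : Continuous φ) (hcd : c ≤ d)
    (hneg : ∀ x ∈ Icc c d, φ x ≤ 0) :
    ∫ x in Icc a b \ Icc c d, φ x ∂μ + ∫ x in Icc c d \ Icc a b, -φ x ≤ charge μ a b c d φ := by
  have h1 := integral_inter_add_sdiff (μ := μ) (t := Icc c d) measurableSet_Icc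
    (integrableOn_Icc_of_continuous hφ a b)
  have h2 := integral_inter_add_sdiff (μ := volume) (t := Icc a b) measurableSet_Icc
    (integrableOn_Icc_of_continuous hφ c d)
  have h3 : ∫ x in Icc a b ∩ Icc c d, -φ x ∂μ ≤ ∫ x in Icc a b ∩ Icc c d, -φ x := by
    refine integral_mono_measure (Measure.restrict_mono le_rfl hle) ?_
      ((integrableOn_Icc_of_continuous hφ.neg a b).mono_set inter_subset_left)
    filter_upwards [ae_restrict_mem (measurableSet_Icc.inter measurableSet_Icc)] with x hx
    simpa using hneg x hx.2
  rw [inter_comm (Icc c d)] at h2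
  rw [integral_neg, integral_neg] at h3
  unfold charge
  rw [intervalIntegral.integral_of_le hcd, ← integral_Icc_eq_integral_Ioc, integral_neg]
  linarith

theorem charge_nonneg [IsFiniteMeasure μ] {φ : ℝ → ℝ} (hle : μ ≤ volume) (hφ : Continuous φ) (hcd : c ≤ d)
    (hneg : ∀ x ∈ Icc c d, φ x ≤ 0) (hpos : ∀ x ∈ Icc a b \ Icc c d, 0 ≤ φ x) :
    0 ≤ charge μ a b c d φ := by
  refine le_trans (add_nonneg ?_ ?_) (charge_ge hle hφ hcd hneg)
  · exact setIntegral_nonneg (measurableSet_Icc.diff measurableSet_Icc) hpos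
  · exact setIntegral_nonneg (measurableSet_Icc.diff measurableSet_Icc)
      fun x hx => neg_nonneg.2 (hneg x hx.1)

theorem charge_pos_of_volume [IsFiniteMeasure μ] {φ : ℝ → ℝ} (hle : μ ≤ volume) (hφ : Continuous φ) (hcd : c ≤ d)
    (hneg : ∀ x ∈ Icc c d, φ x ≤ 0) (hneg' : ∀ x ∈ Ioo c d, φ x < 0)
    (hpos : ∀ x ∈ Icc a b \ Icc c d, 0 ≤ φ x) (hvol : 0 < volume (Ioo c d \ Icc a b)) :
    0 < charge μ a b c d φ := by
  refine lt_of_lt_of_le (add_pos_of_nonneg_of_pos ?_ ?_) (charge_ge hle hφ hcd hneg)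
  · exact setIntegral_nonneg (measurableSet_Icc.diff measurableSet_Icc) hpos
  · rw [setIntegral_pos_iff_support_of_nonneg_ae]
    · refine hvol.trans_le (measure_mono fun x hx => ⟨?_, Ioo_subset_Icc_self hx.1, hx.2⟩)
      exact (neg_pos.2 (hneg' x hx.1)).ne'
    · filter_upwards [ae_restrict_mem (measurableSet_Icc.diff measurableSet_Icc)] with x hx
      exact neg_nonneg.2 (hneg x hx.1)
    · exact (integrableOn_Icc_of_continuous hφ.neg c d).mono_set sdiff_subset

theorem charge_pos_of_measure [IsFiniteMeasure μ] {φ : ℝ → ℝ} (hle : μ ≤ volume) (hφ : Continuous φ) (hcd : c ≤ d)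
    (hneg : ∀ x ∈ Icc c d, φ x ≤ 0) (hpos : ∀ x ∈ Icc a b \ Icc c d, 0 < φ x)
    (hμ : 0 < μ (Icc a b \ Icc c d)) :
    0 < charge μ a b c d φ := by
  refine lt_of_lt_of_le (add_pos_of_pos_of_nonneg ?_ ?_) (charge_ge hle hφ hcd hneg)
  · rw [setIntegral_pos_iff_support_of_nonneg_ae]
    · exact hμ.trans_le (measure_mono fun x hx => ⟨(hpos x hx).ne', hx⟩)
    · filter_upwards [ae_restrict_mem (measurableSet_Icc.diff measurableSet_Icc)] with x hx
      exact (hpos x hx).le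
    · exact (integrableOn_Icc_of_continuous hφ a b).mono_set sdiff_subset
  · exact setIntegral_nonneg (measurableSet_Icc.diff measurableSet_Icc)
      fun x hx => neg_nonneg.2 (hneg x hx.1)

end Charge

/-- If `[c,d]` carried all of `μ`, it would contain the support, hence both `a` and `b`, and so be
too long. -/
theorem measure_diff_Icc_pos {μ : Measure ℝ} {a b c d : ℝ} (ha : a ∈ μ.support)
    (hb : b ∈ μ.support) (hc : μ (Icc a b)ᶜ = 0) (h : d - c < b - a) :
    0 < μ (Icc a b \ Icc c d) := by
  rw [pos_iff_ne_zero]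
  intro h0
  have h1 : μ (Icc c d)ᶜ = 0 := by
    refine measure_mono_null (t := (Icc a b)ᶜ ∪ Icc a b \ Icc c d) (fun x hx => ?_)
      (measure_union_null hc h0)
    by_cases hx' : x ∈ Icc a b
    · exact Or.inr ⟨hx', hx⟩
    · exact Or.inl hx'
  have h2 := Measure.support_subset_of_isClosed isClosed_Icc (mem_ae_iff.2 h1)
  linarith [(h2 ha).1, (h2 hb).2]

/-! ### Partial fractions of the test functions in Cauchy kernels. -/

theorem ofReal_normSq_sub (w : ℂ) (x : ℝ) :
    (Complex.normSq (w - x) : ℂ) = (w - x) * (star w - x) := by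
  rw [← Complex.mul_conj]
  simp

theorem star_sub_ne_zero {w : ℂ} (hw : w ∈ nonreal) : star w - w ≠ 0 := by
  intro h
  apply hw
  have h2 : (star w).im = w.im := by rw [sub_eq_zero.1 h]
  have h3 : (star w).im = -w.im := Complex.conj_im w
  linarith

theorem linear_div_normSq {w : ℂ} (hw : w ∈ nonreal) (α β x : ℝ) :
    (((α * x + β) / Complex.normSq (w - x) : ℝ) : ℂ) =
      (α * w + β) / (star w - w) * (1 / (w - x)) +
        -((α * star w + β) / (star w - w)) * (1 / (star w - x)) := by
  have h1 := sub_ofReal_ne_zero hw x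
  have h2 := sub_ofReal_ne_zero (star_mem_nonreal hw) x
  have h3 := star_sub_ne_zero hw
  push_cast
  rw [ofReal_normSq_sub]
  field_simp
  ring

/-- At a root the linear part has zero charge, so only the charge of the constant `1` survives. -/
theorem quadratic_div_normSq {w : ℂ} (hw : w ∈ nonreal) (c d x : ℝ) :
    (x - c) * (x - d) / Complex.normSq (w - x) =
      1 + ((2 * w.re - c - d) * x + (c * d - Complex.normSq w)) / Complex.normSq (w - x) := by
  have h0 : Complex.normSq (w - x) ≠ 0 := (Complex.normSq_pos.2 (sub_ofReal_ne_zero hw x)).ne'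
  field_simp
  simp only [Complex.normSq_apply, Complex.sub_re, Complex.sub_im, Complex.ofReal_re,
    Complex.ofReal_im]
  ring

/-- The numerator has degree two and the denominator degree four, so the expansion at the four
simple poles `w`, `w̄`, `z`, `z̄` has no polynomial part. -/
theorem quadratic_div_normSq_mul {w z : ℂ} (hw : w ∈ nonreal) (hz : z ∈ nonreal)
    (h1 : w ≠ z) (h2 : w ≠ star z) (c d x : ℝ) :
    (((x - c) * (x - d) / (Complex.normSq (w - x) * Complex.normSq (z - x)) : ℝ) : ℂ) =
      ((w - c) * (w - d) / ((star w - w) * (z - w) * (star z - w)) * (1 / (w - x)) +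
        (star w - c) * (star w - d) / ((w - star w) * (z - star w) * (star z - star w)) *
          (1 / (star w - x))) +
      ((z - c) * (z - d) / ((w - z) * (star w - z) * (star z - z)) * (1 / (z - x)) +
        (star z - c) * (star z - d) / ((w - star z) * (star w - star z) * (z - star z)) *
          (1 / (star z - x))) := by
  have a1 := sub_ofReal_ne_zero hw x
  have a2 := sub_ofReal_ne_zero (star_mem_nonreal hw) x
  have a3 := sub_ofReal_ne_zero hz x
  have a4 := sub_ofReal_ne_zero (star_mem_nonreal hz) x
  have b1 := star_sub_ne_zero hw
  have b2 := star_sub_ne_zero hz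
  have b3 : w - z ≠ 0 := sub_ne_zero.2 h1
  have b4 : w - star z ≠ 0 := sub_ne_zero.2 h2
  have b5 : star w - star z ≠ 0 := sub_ne_zero.2 fun h => h1 (star_injective h)
  have b6 : star w - z ≠ 0 := sub_ne_zero.2 fun h => h2 (by rw [← h, star_star])
  push_cast
  rw [ofReal_normSq_sub, ofReal_normSq_sub]
  generalize star w = w' at *
  generalize star z = z' at *
  have b1' : w - w' ≠ 0 := by rw [← neg_sub]; exact neg_ne_zero.2 b1
  have b2' : z - z' ≠ 0 := by rw [← neg_sub]; exact neg_ne_zero.2 b2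
  have b3' : z - w ≠ 0 := by rw [← neg_sub]; exact neg_ne_zero.2 b3
  have b4' : z' - w ≠ 0 := by rw [← neg_sub]; exact neg_ne_zero.2 b4
  have b5' : z' - w' ≠ 0 := by rw [← neg_sub]; exact neg_ne_zero.2 b5
  have b6' : z - w' ≠ 0 := by rw [← neg_sub]; exact neg_ne_zero.2 b6
  rw [show w - w' = -(w' - w) by ring, show z - w = -(w - z) by ring,
    show z' - w = -(w - z') by ring, show z - w' = -(w' - z) by ring,
    show z' - w' = -(w' - z') by ring, show z - z' = -(z' - z) by ring]
  field_simp
  ring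

theorem sub_star_eq (z : ℂ) : z - star z = ((2 * z.im : ℝ) : ℂ) * Complex.I :=
  Complex.sub_conj z

/-! ### Roots of `f'` and the explicit formula for the liquid point. -/

theorem fDeriv_eq_charge (μ : Measure ℝ) (a b : ℝ) (p : ℝ × ℝ) (w : ℂ) :
    fDeriv μ a b p w =
      charge μ a b (p.1 + p.2 - 1) p.1 (fun x : ℝ => 1 / (w - (x : ℂ))) := rfl

theorem fDeriv_star (μ : Measure ℝ) (a b : ℝ) (p : ℝ × ℝ) (w : ℂ) :
    fDeriv μ a b p (star w) = star (fDeriv μ a b p w) := by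
  rw [fDeriv_eq_charge, fDeriv_eq_charge, charge_kernel_star]

theorem exp_cauchy_ne_star {μ : Measure ℝ} [IsProbabilityMeasure μ] {a b : ℝ} (hle : μ ≤ volume)
    (hc : μ (Icc a b)ᶜ = 0) (hab : a ≤ b) {w : ℂ} (hw : w ∈ upperHalf) :
    Complex.exp (cauchy μ a b w) ≠ Complex.exp (cauchy μ a b (star w)) := by
  rw [cauchy_star, exp_star]
  intro h
  have h1 := congrArg Complex.im h
  have h2 : (star (Complex.exp (cauchy μ a b w))).im = -(Complex.exp (cauchy μ a b w)).im :=
    Complex.conj_im _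
  have h3 := exp_cauchy_im_neg hle hc hab hw
  linarith

theorem eq_liquidPoint_of_fDeriv_eq_zero {μ : Measure ℝ} [IsProbabilityMeasure μ] {a b : ℝ}
    (hle : μ ≤ volume) (hc : μ (Icc a b)ᶜ = 0) (hab : a ≤ b) {w : ℂ} (hw : w ∈ upperHalf)
    {p : ℝ × ℝ} (h : fDeriv μ a b p w = 0) : p = liquidPoint μ a b w := by
  have hn := upperHalf_subset_nonreal hw
  have hne := exp_cauchy_ne_star hle hc hab hw
  have hchi := chiL_eq μ a b w hne
  have heta := etaL_eq μ a b w hne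
  have hE : Complex.exp (cauchy μ a b w) * (w - p.1) = w - (p.1 + p.2 - 1) := by
    rw [sub_eq_zero.1 h, exp_intervalIntegral_kernel hn,
      div_mul_cancel₀ _ (sub_ofReal_ne_zero hn p.1)]
    push_cast
    ring
  have hE' : star (Complex.exp (cauchy μ a b w)) * (star w - p.1) = star w - (p.1 + p.2 - 1) := by
    have := congrArg star hE
    simpa [Complex.conj_ofReal] using this
  unfold chiLC at hchi
  unfold etaLC at heta
  rw [cauchy_star, exp_star] at hchi heta hne
  generalize Complex.exp (cauchy μ a b w) = e at *
  have h1 : e - star e ≠ 0 := sub_ne_zero.2 hne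
  -- Subtracting the conjugate equation eliminates `χ + η - 1` and leaves a linear equation for `χ`
  -- alone.
  have hw1 : (w - p.1) * (e - star e) = -((w - star w) * (star e - 1)) := by
    linear_combination hE - hE'
  have hchi' : (p.1 : ℂ) = w + (w - star w) * (star e - 1) / (e - star e) := by
    field_simp
    linear_combination -hw1
  have heta' : (p.2 : ℂ) = 1 + (w - star w) * (e - 1) * (star e - 1) / (e - star e) := by
    field_simp
    linear_combination (e - star e) * hE - (e - 1) * hw1
  rw [← hchi] at hchi'
  rw [← heta] at heta'
  exact Prod.ext (Complex.ofReal_injective hchi') (Complex.ofReal_injective heta')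

/-- With `e = e^{C(w)}`, the formula becomes `η - 1 = Im w · |e - 1|² / Im e`, and `Im e < 0`. -/
theorem liquidPoint_snd_lt_one {μ : Measure ℝ} [IsProbabilityMeasure μ] {a b : ℝ}
    (hle : μ ≤ volume) (hc : μ (Icc a b)ᶜ = 0) (hab : a ≤ b) {w : ℂ} (hw : w ∈ upperHalf) :
    (liquidPoint μ a b w).2 < 1 := by
  have heta := etaL_eq μ a b w (exp_cauchy_ne_star hle hc hab hw)
  have him := exp_cauchy_im_neg hle hc hab hw
  unfold etaLC at heta
  rw [cauchy_star, exp_star] at heta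
  generalize Complex.exp (cauchy μ a b w) = e at *
  have h1 : (e - 1) * (star e - 1) = (Complex.normSq (e - 1) : ℂ) := by
    rw [← Complex.mul_conj]
    simp
  have h2 : (e.im : ℂ) ≠ 0 := Complex.ofReal_ne_zero.2 him.ne
  rw [mul_assoc, h1, sub_star_eq, sub_star_eq] at heta
  have h3 : (liquidPoint μ a b w).2 = 1 + w.im * Complex.normSq (e - 1) / e.im := by
    apply Complex.ofReal_injective
    rw [heta]
    push_cast
    field_simp
  have h4 : 0 < Complex.normSq (e - 1) := by
    rw [Complex.normSq_pos]
    intro h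
    rw [sub_eq_zero.1 h] at him
    simp at him
  have h5 : w.im * Complex.normSq (e - 1) / e.im < 0 :=
    div_neg_of_pos_of_neg (mul_pos hw h4) him
  linarith

theorem fDeriv_liquidPoint {μ : Measure ℝ} [IsProbabilityMeasure μ] {a b : ℝ}
    (hle : μ ≤ volume) (hc : μ (Icc a b)ᶜ = 0) (hab : a ≤ b) {w : ℂ} (hw : w ∈ upperHalf) :
    fDeriv μ a b (liquidPoint μ a b w) w = 0 := by
  have hn := upperHalf_subset_nonreal hw
  have hne := exp_cauchy_ne_star hle hc hab hw
  have hchi := chiL_eq μ a b w hne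
  have heta := etaL_eq μ a b w hne
  have hlt := liquidPoint_snd_lt_one hle hc hab hw
  obtain ⟨hb1, hb2⟩ := cauchy_im_bounds hle hc hab hw
  set p := liquidPoint μ a b w
  obtain ⟨hi1, hi2⟩ := intervalIntegral_kernel_im_bounds hw (c := p.1 + p.2 - 1) (d := p.1)
    (by linarith)
  have hpi := Real.pi_pos
  -- Both sides have imaginary part in `(-π, 0]`, so it suffices to compare exponentials. The bound
  -- for the interval integral needs `χ + η - 1 ≤ χ`, which is where `η < 1` enters.
  refine sub_eq_zero.2 (Complex.exp_inj_of_neg_pi_lt_of_le_pi hb1 (by linarith) hi1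
    (by linarith) ?_)
  rw [exp_intervalIntegral_kernel hn, eq_div_iff (sub_ofReal_ne_zero hn _)]
  push_cast
  rw [hchi, heta]
  unfold chiLC etaLC
  rw [cauchy_star, exp_star] at hne ⊢
  generalize Complex.exp (cauchy μ a b w) = e at *
  have h1 : e - star e ≠ 0 := sub_ne_zero.2 hne
  field_simp
  ring

/-! ### Test functions that place the liquid point in the admissible region. -/

section Shape

variable {μ : Measure ℝ} {a b c d : ℝ} {w : ℂ}

theorem continuous_div_normSq (hw : w ∈ nonreal) {f : ℝ → ℝ} (hf : Continuous f) :
    Continuous fun x : ℝ => f x / Complex.normSq (w - x) :=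
  hf.div (Complex.continuous_normSq.comp (by fun_prop))
    fun x => (Complex.normSq_pos.2 (sub_ofReal_ne_zero hw x)).ne'

theorem charge_kernel_combination [IsFiniteMeasure μ] {z : ℂ} (hw : w ∈ nonreal)
    (hz : z ∈ nonreal) (r s : ℂ) :
    charge μ a b c d (fun x : ℝ => r * (1 / (w - (x : ℂ))) + s * (1 / (z - (x : ℂ)))) =
      r * charge μ a b c d (fun x : ℝ => 1 / (w - (x : ℂ))) +
        s * charge μ a b c d (fun x : ℝ => 1 / (z - (x : ℂ))) := by
  rw [← charge_const_mul, ← charge_const_mul]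
  exact charge_add (continuous_const.mul (continuous_kernel hw))
    (continuous_const.mul (continuous_kernel hz))

theorem continuous_kernel_combination {z : ℂ} (hw : w ∈ nonreal) (hz : z ∈ nonreal) (r s : ℂ) :
    Continuous fun x : ℝ => r * (1 / (w - (x : ℂ))) + s * (1 / (z - (x : ℂ))) :=
  (continuous_const.mul (continuous_kernel hw)).add (continuous_const.mul (continuous_kernel hz))

theorem charge_quadratic_div_normSq_mul [IsFiniteMeasure μ] {z : ℂ} (hw : w ∈ nonreal)
    (hz : z ∈ nonreal) (h1 : w ≠ z) (h2 : w ≠ star z)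
    (h : charge μ a b c d (fun x : ℝ => 1 / (w - (x : ℂ))) = 0) :
    ((charge μ a b c d (fun x => (x - c) * (x - d) /
        (Complex.normSq (w - x) * Complex.normSq (z - x))) : ℝ) : ℂ) =
      (z - c) * (z - d) / ((w - z) * (star w - z) * (star z - z)) *
          charge μ a b c d (fun x : ℝ => 1 / (z - (x : ℂ))) +
        (star z - c) * (star z - d) / ((w - star z) * (star w - star z) * (z - star z)) *
          charge μ a b c d (fun x : ℝ => 1 / (star z - (x : ℂ))) := by
  rw [← charge_ofReal]
  simp only [quadratic_div_normSq_mul hw hz h1 h2]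
  refine (charge_add (continuous_kernel_combination hw (star_mem_nonreal hw) _ _)
    (continuous_kernel_combination hz (star_mem_nonreal hz) _ _)).trans ?_
  rw [charge_kernel_combination hw (star_mem_nonreal hw),
    charge_kernel_combination hz (star_mem_nonreal hz), charge_kernel_star w, h]
  simp

theorem charge_linear_div_normSq [IsFiniteMeasure μ] (hw : w ∈ nonreal)
    (h : charge μ a b c d (fun x : ℝ => 1 / (w - (x : ℂ))) = 0) (α β : ℝ) :
    charge μ a b c d (fun x => (α * x + β) / Complex.normSq (w - x)) = 0 := by
  apply Complex.ofReal_injective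
  rw [← charge_ofReal]
  simp only [linear_div_normSq hw]
  rw [charge_add, charge_const_mul, charge_const_mul, charge_kernel_star, h]
  · simp
  · exact continuous_const.mul (continuous_kernel hw)
  · exact continuous_const.mul (continuous_kernel (star_mem_nonreal hw))

/-- The test function `(x - c)(x - d)/|w - x|²` matches the sign of the charge. At a root its charge
equals that of the constant `1`, namely `1 - (d - c)`. -/
theorem length_le_one_of_charge_eq_zero [IsProbabilityMeasure μ] (hle : μ ≤ volume)
    (hc : μ (Icc a b)ᶜ = 0) (hcd : c ≤ d) (hw : w ∈ nonreal)
    (h : charge μ a b c d (fun x : ℝ => 1 / (w - (x : ℂ))) = 0) : d - c ≤ 1 := by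
  have h0 : 0 ≤ charge μ a b c d (fun x => (x - c) * (x - d) / Complex.normSq (w - x)) := by
    refine charge_nonneg hle (continuous_div_normSq hw (by fun_prop)) hcd ?_ ?_
    · exact fun x hx => div_nonpos_of_nonpos_of_nonneg
        (mul_nonpos_of_nonneg_of_nonpos (by linarith [hx.1]) (by linarith [hx.2]))
        (Complex.normSq_nonneg _)
    · intro x hx
      refine div_nonneg ?_ (Complex.normSq_nonneg _)
      rcases lt_or_ge x c with h1 | h1
      · exact mul_nonneg_of_nonpos_of_nonpos (by linarith) (by linarith)
      · have h2 : d < x := not_le.1 fun h2 => hx.2 ⟨h1, h2⟩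
        exact mul_nonneg (by linarith) (by linarith)
  simp only [quadratic_div_normSq hw] at h0
  rw [charge_add continuous_const (continuous_div_normSq hw (by fun_prop)),
    charge_linear_div_normSq hw h] at h0
  have hm : μ.real (Icc a b) = 1 := by
    rw [measureReal_def, (prob_compl_eq_zero_iff measurableSet_Icc).1 hc, ENNReal.toReal_one]
  have h1 : charge μ a b c d (fun _ => (1 : ℝ)) = 1 - (d - c) := by
    simp [charge, hm]
  linarith

/-- If `c < a`, then `μ` is not integrated to the left of `c`, so `(x - d)/|w - x|²` matches the
sign of the charge. The uncovered piece `(c, min a d)` makes its charge strictly positive, while a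
root forces it to vanish. -/
theorem left_le_of_charge_eq_zero [IsFiniteMeasure μ] (hle : μ ≤ volume) (hcd : c < d)
    (hw : w ∈ nonreal)
    (h : charge μ a b c d (fun x : ℝ => 1 / (w - (x : ℂ))) = 0) : a ≤ c := by
  by_contra! hac
  have hpos : ∀ x : ℝ, 0 < Complex.normSq (w - x) := fun x =>
    Complex.normSq_pos.2 (sub_ofReal_ne_zero hw x)
  have h0 := charge_linear_div_normSq hw h 1 (-d)
  refine (charge_pos_of_volume hle (continuous_div_normSq hw (by fun_prop)) hcd.le ?_ ?_ ?_
    ?_).ne' h0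
  · exact fun x hx => div_nonpos_of_nonpos_of_nonneg (by linarith [hx.2]) (hpos x).le
  · exact fun x hx => div_neg_of_neg_of_pos (by linarith [hx.2]) (hpos x)
  · intro x hx
    have h2 : d < x := not_le.1 fun h2 => hx.2 ⟨by linarith [hx.1.1], h2⟩
    exact div_nonneg (by linarith) (hpos x).le
  · refine lt_of_lt_of_le ?_ (measure_mono (s := Ioo c (min a d)) fun x hx => ⟨⟨hx.1, ?_⟩, ?_⟩)
    · rw [Real.volume_Ioo, ENNReal.ofReal_pos]
      exact sub_pos.2 (lt_min hac hcd)
    · exact hx.2.trans_le (min_le_right _ _)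
    · exact fun hx' => absurd hx'.1 (not_le.2 (hx.2.trans_le (min_le_left _ _)))

theorem right_le_of_charge_eq_zero [IsFiniteMeasure μ] (hle : μ ≤ volume) (hcd : c < d)
    (hw : w ∈ nonreal)
    (h : charge μ a b c d (fun x : ℝ => 1 / (w - (x : ℂ))) = 0) : d ≤ b := by
  by_contra! hbd
  have hpos : ∀ x : ℝ, 0 < Complex.normSq (w - x) := fun x =>
    Complex.normSq_pos.2 (sub_ofReal_ne_zero hw x)
  have h0 := charge_linear_div_normSq hw h (-1) c
  refine (charge_pos_of_volume hle (continuous_div_normSq hw (by fun_prop)) hcd.le ?_ ?_ ?_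
    ?_).ne' h0
  · exact fun x hx => div_nonpos_of_nonpos_of_nonneg (by linarith [hx.1]) (hpos x).le
  · exact fun x hx => div_neg_of_neg_of_pos (by linarith [hx.1]) (hpos x)
  · intro x hx
    have h2 : x < c := not_le.1 fun h2 => hx.2 ⟨h2, by linarith [hx.1.2]⟩
    exact div_nonneg (by linarith) (hpos x).le
  · refine lt_of_lt_of_le ?_ (measure_mono (s := Ioo (max b c) d) fun x hx => ⟨⟨?_, hx.2⟩, ?_⟩)
    · rw [Real.volume_Ioo, ENNReal.ofReal_pos]
      exact sub_pos.2 (max_lt hbd hcd)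
    · exact (le_max_right _ _).trans_lt hx.1
    · exact fun hx' => absurd hx'.2 (not_le.2 ((le_max_left _ _).trans_lt hx.1))

end Shape

/-! ### The bijection with the liquid region, and separation from boundary limits. -/

theorem liquidPoint_mem_shape {μ : Measure ℝ} [IsProbabilityMeasure μ] {a b : ℝ}
    (hle : μ ≤ volume) (hc : μ (Icc a b)ᶜ = 0) (hab : a ≤ b) {w : ℂ} (hw : w ∈ upperHalf) :
    liquidPoint μ a b w ∈ shape a b := by
  have hn := upperHalf_subset_nonreal hw
  have hlt := liquidPoint_snd_lt_one hle hc hab hw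
  have h0 := fDeriv_liquidPoint hle hc hab hw
  set p := liquidPoint μ a b w
  have hcd : p.1 + p.2 - 1 < p.1 := by linarith
  rw [fDeriv_eq_charge] at h0
  have h1 := length_le_one_of_charge_eq_zero hle hc hcd.le hn h0
  have h2 := left_le_of_charge_eq_zero hle hcd hn h0
  have h3 := right_le_of_charge_eq_zero hle hcd hn h0
  refine ⟨⟨⟨by linarith, h3⟩, by linarith, hlt.le⟩, h2, hcd.le, h3⟩

theorem liquidPoint_mem_liquid {μ : Measure ℝ} [IsProbabilityMeasure μ] {a b : ℝ}
    (hle : μ ≤ volume) (hc : μ (Icc a b)ᶜ = 0) (hab : a ≤ b) {w : ℂ} (hw : w ∈ upperHalf) :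
    liquidPoint μ a b w ∈ liquid μ a b :=
  ⟨liquidPoint_mem_shape hle hc hab hw, w, ne_of_gt hw, fDeriv_liquidPoint hle hc hab hw⟩

theorem exists_eq_liquidPoint_of_mem_liquid {μ : Measure ℝ} [IsProbabilityMeasure μ] {a b : ℝ}
    (hle : μ ≤ volume) (hc : μ (Icc a b)ᶜ = 0) (hab : a ≤ b) {p : ℝ × ℝ}
    (hp : p ∈ liquid μ a b) : ∃ w ∈ upperHalf, liquidPoint μ a b w = p := by
  obtain ⟨_, w, hw, h⟩ := hp
  rcases lt_or_gt_of_ne hw with hw' | hw'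
  · have him : (star w).im = -w.im := Complex.conj_im w
    have hs : star w ∈ upperHalf := by
      change 0 < (star w).im
      linarith
    refine ⟨star w, hs, (eq_liquidPoint_of_fDeriv_eq_zero hle hc hab hs ?_).symm⟩
    rw [fDeriv_star, h, star_zero]
  · exact ⟨w, hw', (eq_liquidPoint_of_fDeriv_eq_zero hle hc hab hw' h).symm⟩

set_option maxHeartbeats 800000 in
/-- Distinct boundary limits cannot share their image with a point of the half plane. -/
theorem not_tendsto_liquidPoint {μ : Measure ℝ} [IsProbabilityMeasure μ] {a b : ℝ}
    (hle : μ ≤ volume) (ha : a ∈ μ.support) (hb : b ∈ μ.support)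
    (hc : μ (Icc a b)ᶜ = 0) (hab : 1 < b - a) {z w₀ : ℂ} (hw₀ : w₀ ∈ upperHalf)
    (hz : z ≠ w₀) (hz' : z ≠ star w₀) {w : ℕ → ℂ} (hw : ∀ n, w n ∈ upperHalf)
    (hwz : Tendsto w atTop (𝓝 z)) :
    ¬ Tendsto (fun n => liquidPoint μ a b (w n)) atTop (𝓝 (liquidPoint μ a b w₀)) := by
  intro hlim
  have hab' : a ≤ b := by linarith
  have hn₀ := upperHalf_subset_nonreal hw₀
  have hn : ∀ n, w n ∈ nonreal := fun n => upperHalf_subset_nonreal (hw n)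
  set p : ℕ → ℝ × ℝ := fun n => liquidPoint μ a b (w n)
  set p₀ := liquidPoint μ a b w₀
  have hshape : ∀ n, p n ∈ shape a b := fun n => liquidPoint_mem_shape hle hc hab' (hw n)
  have hshape₀ : p₀ ∈ shape a b := liquidPoint_mem_shape hle hc hab' hw₀
  set c : ℕ → ℝ := fun n => (p n).1 + (p n).2 - 1
  set d : ℕ → ℝ := fun n => (p n).1
  set c₀ : ℝ := p₀.1 + p₀.2 - 1
  set d₀ : ℝ := p₀.1
  have hd : Tendsto d atTop (𝓝 d₀) := (continuous_fst.tendsto _).comp hlim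
  have hcc : Tendsto c atTop (𝓝 c₀) :=
    ((by fun_prop : Continuous fun q : ℝ × ℝ => q.1 + q.2 - 1).tendsto _).comp hlim
  have hcharge : ∀ {E : Type} [NormedAddCommGroup E] [NormedSpace ℝ E] [CompleteSpace E]
      {f : ℝ → E}, Continuous f → Tendsto (fun n => charge μ a b (c n) (d n) f) atTop
        (𝓝 (charge μ a b c₀ d₀ f)) := fun hf =>
    ((continuous_charge hf).tendsto (c₀, d₀)).comp (hcc.prodMk_nhds hd)
  -- the charge of the quadratic vanishing at both endpoints
  let Q : ℝ → ℝ → ℝ := fun c d => charge μ a b c d (fun x => (x - c) * (x - d))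
  have hQ : Tendsto (fun n => Q (c n) (d n)) atTop (𝓝 (Q c₀ d₀)) := by
    -- The integrand moves with the endpoints. Expanding it reduces the claim to charges of fixed
    -- functions, which are continuous in the endpoints.
    have hform : ∀ c d : ℝ, Q c d = charge μ a b c d (fun x => x ^ 2) +
        (-(c + d)) * charge μ a b c d (fun x => x) + (c * d) * charge μ a b c d (fun _ => 1) := by
      intro c d
      rw [← charge_const_mul, ← charge_const_mul, ← charge_add (by fun_prop) (by fun_prop),
        ← charge_add (by fun_prop) (by fun_prop)]
      simp only [Q]
      congr 1
      funext x
      ring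
    simp only [hform]
    exact ((hcharge (by fun_prop)).add ((hcc.add hd).neg.mul (hcharge (by fun_prop)))).add
      ((hcc.mul hd).mul (hcharge (by fun_prop)))
  have hQpos : 0 < Q c₀ d₀ := by
    have hcd : c₀ ≤ d₀ := hshape₀.2.2.1
    refine charge_pos_of_measure hle (by fun_prop) hcd ?_ ?_
      (measure_diff_Icc_pos ha hb hc ?_)
    · exact fun x hx => mul_nonpos_of_nonneg_of_nonpos (by linarith [hx.1]) (by linarith [hx.2])
    · intro x hx
      rcases lt_or_ge x c₀ with h1 | h1
      · exact mul_pos_of_neg_of_neg (by linarith) (by linarith)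
      · have h2 : d₀ < x := not_le.1 fun h2 => hx.2 ⟨h1, h2⟩
        exact mul_pos (by linarith) (by linarith)
    · have : 0 ≤ p₀.2 := hshape₀.1.2.1
      simp only [c₀, d₀]
      linarith
  -- a uniform bound for the denominators
  obtain ⟨K, hK, hKb⟩ : ∃ K > 0, ∀ᶠ n in atTop, ∀ x ∈ Icc a b,
      Complex.normSq (w n - x) * Complex.normSq (w₀ - x) ≤ K := by
    set B := |a| + |b|
    have hx : ∀ x ∈ Icc a b, ‖(x : ℂ)‖ ≤ B := by
      intro x hx
      rw [Complex.norm_real, Real.norm_eq_abs]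
      refine abs_le.2 ⟨?_, ?_⟩
      · linarith [neg_abs_le a, abs_nonneg b, hx.1]
      · linarith [le_abs_self b, abs_nonneg a, hx.2]
    refine ⟨(‖z‖ + 1 + B) ^ 2 * (‖w₀‖ + 1 + B) ^ 2, by positivity, ?_⟩
    have h1 : ∀ᶠ n in atTop, ‖w n‖ < ‖z‖ + 1 := hwz.norm.eventually_lt_const (by linarith)
    filter_upwards [h1] with n hn x hxI
    rw [Complex.normSq_eq_norm_sq, Complex.normSq_eq_norm_sq]
    have h2 : ‖w n - x‖ ≤ ‖z‖ + 1 + B := (norm_sub_le _ _).trans (by linarith [hx x hxI])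
    have h3 : ‖w₀ - x‖ ≤ ‖w₀‖ + 1 + B := (norm_sub_le _ _).trans (by linarith [hx x hxI])
    gcongr
  -- the charge of the quadratic divided by the denominators tends to zero
  let φ : ℕ → ℝ → ℝ := fun n x => (x - c n) * (x - d n) /
    (Complex.normSq (w n - x) * Complex.normSq (w₀ - x))
  have hφc : ∀ n, Continuous (φ n) := by
    intro n
    refine Continuous.div (by fun_prop) ((Complex.continuous_normSq.comp (by fun_prop)).mul
      (Complex.continuous_normSq.comp (by fun_prop))) fun x => mul_ne_zero ?_ ?_
    · exact (Complex.normSq_pos.2 (sub_ofReal_ne_zero (hn n) x)).ne'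
    · exact (Complex.normSq_pos.2 (sub_ofReal_ne_zero hn₀ x)).ne'
  have hstar : Tendsto (fun n => star (w n)) atTop (𝓝 (star z)) :=
    (continuous_star.tendsto z).comp hwz
  -- The kernels at `w n` and its conjugate have charge zero exactly. Those at `w₀` and its
  -- conjugate have charge tending to zero, with convergent coefficients because `z` avoids both
  -- points.
  have hφlim : Tendsto (fun n => charge μ a b (c n) (d n) (φ n)) atTop (𝓝 0) := by
    have e1 : ∀ᶠ n in atTop, w n ≠ w₀ := hwz.eventually_ne hz
    have e2 : ∀ᶠ n in atTop, w n ≠ star w₀ := hwz.eventually_ne hz'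
    have e3 : star z ≠ star w₀ := fun h => hz (star_injective h)
    have e4 : star z ≠ w₀ := fun h => hz' (by rw [← h, star_star])
    have b1 := star_sub_ne_zero hn₀
    have b2 : w₀ - star w₀ ≠ 0 := by rw [← neg_sub]; exact neg_ne_zero.2 b1
    have hcC : Tendsto (fun n => (c n : ℂ)) atTop (𝓝 (c₀ : ℂ)) :=
      (Complex.continuous_ofReal.tendsto _).comp hcc
    have hdC : Tendsto (fun n => (d n : ℂ)) atTop (𝓝 (d₀ : ℂ)) :=
      (Complex.continuous_ofReal.tendsto _).comp hd
    have hroot₀ : charge μ a b c₀ d₀ (fun x : ℝ => 1 / (w₀ - (x : ℂ))) = 0 :=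
      fDeriv_liquidPoint hle hc hab' hw₀
    have hroot : ∀ n, charge μ a b (c n) (d n) (fun x : ℝ => 1 / (w n - (x : ℂ))) = 0 :=
      fun n => fDeriv_liquidPoint hle hc hab' (hw n)
    have t1 := hcharge (continuous_kernel hn₀)
    have t2 := hcharge (continuous_kernel (star_mem_nonreal hn₀))
    rw [charge_kernel_star, hroot₀, star_zero] at t2
    rw [hroot₀] at t1
    have key : Tendsto (fun n =>
        (w₀ - c n) * (w₀ - d n) / ((w n - w₀) * (star (w n) - w₀) * (star w₀ - w₀)) *
          charge μ a b (c n) (d n) (fun x : ℝ => 1 / (w₀ - (x : ℂ))) +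
        (star w₀ - c n) * (star w₀ - d n) /
          ((w n - star w₀) * (star (w n) - star w₀) * (w₀ - star w₀)) *
          charge μ a b (c n) (d n) (fun x : ℝ => 1 / (star w₀ - (x : ℂ)))) atTop (𝓝 (0 : ℂ)) := by
      have l1 := ((((hcC.const_sub w₀).mul (hdC.const_sub w₀)).div
        (((hwz.sub_const w₀).mul (hstar.sub_const w₀)).mul_const (star w₀ - w₀))
        (mul_ne_zero (mul_ne_zero (sub_ne_zero.2 hz) (sub_ne_zero.2 e4)) b1)).mul t1)
      have l2 := ((((hcC.const_sub (star w₀)).mul (hdC.const_sub (star w₀))).div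
        (((hwz.sub_const (star w₀)).mul (hstar.sub_const (star w₀))).mul_const (w₀ - star w₀))
        (mul_ne_zero (mul_ne_zero (sub_ne_zero.2 hz') (sub_ne_zero.2 e3)) b2)).mul t2)
      simpa using l1.add l2
    have heq : (fun n => ((charge μ a b (c n) (d n) (φ n) : ℝ) : ℂ)) =ᶠ[atTop] fun n =>
        (w₀ - c n) * (w₀ - d n) / ((w n - w₀) * (star (w n) - w₀) * (star w₀ - w₀)) *
          charge μ a b (c n) (d n) (fun x : ℝ => 1 / (w₀ - (x : ℂ))) +
        (star w₀ - c n) * (star w₀ - d n) /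
          ((w n - star w₀) * (star (w n) - star w₀) * (w₀ - star w₀)) *
          charge μ a b (c n) (d n) (fun x : ℝ => 1 / (star w₀ - (x : ℂ))) := by
      filter_upwards [e1, e2] with n h1 h2
      exact charge_quadratic_div_normSq_mul (hn n) hn₀ h1 h2 (hroot n)
    have := (Complex.continuous_re.tendsto _).comp (key.congr' heq.symm)
    simpa [Function.comp_def] using this
  -- On `[a,b]` the factor `1/(|w n - x|² |w₀ - x|²) - 1/K` is nonnegative, so the difference keeps
  -- the sign pattern of `(x - c)(x - d)`. The inclusion `[c n, d n] ⊆ [a,b]` makes this bound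
  -- available on all of `[c n, d n]`.
  have hlow : ∀ᶠ n in atTop, 1 / K * Q (c n) (d n) ≤ charge μ a b (c n) (d n) (φ n) := by
    filter_upwards [hKb] with n hKn
    rw [← sub_nonneg]
    have hsub : charge μ a b (c n) (d n) (φ n) - 1 / K * Q (c n) (d n) =
        charge μ a b (c n) (d n) (fun x => φ n x - 1 / K * ((x - c n) * (x - d n))) := by
      rw [charge_sub (hφc n) (by fun_prop), charge_const_mul]
    rw [hsub]
    have hfac : ∀ x ∈ Icc a b, ∃ r : ℝ, 0 ≤ r ∧
        φ n x - 1 / K * ((x - c n) * (x - d n)) = (x - c n) * (x - d n) * r := by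
      intro x hx
      refine ⟨1 / (Complex.normSq (w n - x) * Complex.normSq (w₀ - x)) - 1 / K, ?_, ?_⟩
      · refine sub_nonneg.2 (one_div_le_one_div_of_le (mul_pos ?_ ?_) (hKn x hx))
        · exact Complex.normSq_pos.2 (sub_ofReal_ne_zero (hn n) x)
        · exact Complex.normSq_pos.2 (sub_ofReal_ne_zero hn₀ x)
      · simp only [φ]
        ring
    have hcd : c n ≤ d n := (hshape n).2.2.1
    refine charge_nonneg hle ((hφc n).sub (by fun_prop)) hcd ?_ ?_
    · intro x hx
      obtain ⟨r, hr, he⟩ := hfac x ⟨(hshape n).2.1.trans hx.1, hx.2.trans (hshape n).2.2.2⟩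
      rw [he]
      exact mul_nonpos_of_nonpos_of_nonneg
        (mul_nonpos_of_nonneg_of_nonpos (by linarith [hx.1]) (by linarith [hx.2])) hr
    · intro x hx
      obtain ⟨r, hr, he⟩ := hfac x hx.1
      rw [he]
      refine mul_nonneg ?_ hr
      rcases lt_or_ge x (c n) with h1 | h1
      · exact mul_nonneg_of_nonpos_of_nonpos (by linarith) (by linarith)
      · have h2 : d n < x := not_le.1 fun h2 => hx.2 ⟨h1, h2⟩
        exact mul_nonneg (by linarith) (by linarith)
  have hfin := le_of_tendsto_of_tendsto (hQ.const_mul (1 / K)) hφlim hlow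
  exact absurd hfin (not_le.2 (mul_pos (one_div_pos.2 hK) hQpos))

/-- This is the constant-sequence case of `not_tendsto_liquidPoint`. -/
theorem liquidPoint_injOn {μ : Measure ℝ} [IsProbabilityMeasure μ] {a b : ℝ}
    (hle : μ ≤ volume) (ha : a ∈ μ.support) (hb : b ∈ μ.support)
    (hc : μ (Icc a b)ᶜ = 0) (hab : 1 < b - a) : InjOn (liquidPoint μ a b) upperHalf := by
  intro w hw w₀ hw₀ h
  by_contra hne
  refine not_tendsto_liquidPoint hle ha hb hc hab hw₀ hne ?_ (fun _ => hw)
    (tendsto_const_nhds (f := (atTop : Filter ℕ))) ?_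
  · intro h2
    have h3 : (star w₀).im = -w₀.im := Complex.conj_im w₀
    have h4 : 0 < w.im := hw
    have h5 : 0 < w₀.im := hw₀
    rw [h2, h3] at h4
    linarith
  · rw [h]
    exact tendsto_const_nhds

/-! ### Analytic extension across the real line. -/

section Extension

theorem ofReal_mem_closure_upperHalf (t : ℝ) : (t : ℂ) ∈ closure upperHalf := by
  have h : Tendsto (fun n : ℕ => (t : ℂ) + ((1 / ((n : ℝ) + 1) : ℝ) : ℂ) * Complex.I) atTop
      (𝓝 (t : ℂ)) := by
    have h1 := (Complex.continuous_ofReal.tendsto 0).comp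
      (tendsto_one_div_add_atTop_nhds_zero_nat (𝕜 := ℝ))
    simpa [Function.comp_def] using (h1.mul_const Complex.I).const_add (t : ℂ)
  refine mem_closure_of_tendsto h (Eventually.of_forall fun n => ?_)
  have : (0 : ℝ) < 1 / ((n : ℝ) + 1) := by positivity
  change 0 < ((t : ℂ) + ((1 / ((n : ℝ) + 1) : ℝ) : ℂ) * Complex.I).im
  rw [Complex.add_im, Complex.ofReal_im, Complex.im_ofReal_mul, Complex.I_im]
  linarith

theorem mem_closure_nonreal (w : ℂ) : w ∈ closure nonreal := by
  by_cases h : w.im = 0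
  · have : w = (w.re : ℂ) := Complex.ext (by simp) (by simp [h])
    rw [this]
    exact closure_mono upperHalf_subset_nonreal (ofReal_mem_closure_upperHalf _)
  · exact subset_closure h

instance neBot_nhdsWithin_upperHalf (t : ℝ) : (𝓝[upperHalf] (t : ℂ)).NeBot :=
  mem_closure_iff_nhdsWithin_neBot.1 (ofReal_mem_closure_upperHalf t)

/-- Every point near `w`, real ones included, is a limit of nonreal points, so continuity of `H`
there determines the extended value. -/
theorem extendFrom_nonreal_eventuallyEq {f H : ℂ → ℂ} {w : ℂ} (hH : AnalyticAt ℂ H w)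
    (h : ∀ᶠ z in 𝓝 w, z ∈ nonreal → f z = H z) : extendFrom nonreal f =ᶠ[𝓝 w] H := by
  filter_upwards [hH.eventually_analyticAt, h.eventually_nhds] with z hz hfz
  refine extendFrom_eq (mem_closure_nonreal z) ?_
  refine (hz.continuousAt.tendsto.mono_left nhdsWithin_le_nhds).congr' ?_
  filter_upwards [nhdsWithin_le_nhds hfz, self_mem_nhdsWithin] with y hy hyn
  exact (hy hyn).symm

theorem isAnalyticExtension_extendFrom {f : ℂ → ℂ} {S : Set ℝ}
    (hf : ∀ w ∈ nonreal, AnalyticAt ℂ f w)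
    (hS : ∀ t ∉ S, ∃ H : ℂ → ℂ, AnalyticAt ℂ H (t : ℂ) ∧
      ∀ᶠ z in 𝓝 (t : ℂ), z ∈ nonreal → f z = H z) :
    IsAnalyticExtension f (extendFrom nonreal f) S := by
  have hloc : ∀ w ∈ nonreal, extendFrom nonreal f =ᶠ[𝓝 w] f := fun w hw =>
    extendFrom_nonreal_eventuallyEq (hf w hw) (Eventually.of_forall fun _ _ => rfl)
  refine ⟨fun w hw => ?_, fun w hw => (hloc w hw).eq_of_nhds⟩
  by_cases h : w.im = 0
  · have hwr : w = (w.re : ℂ) := Complex.ext (by simp) (by simp [h])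
    rw [hwr] at hw ⊢
    obtain ⟨H, hH, hfH⟩ := hS w.re fun hmem => hw ⟨_, hmem, rfl⟩
    exact hH.congr (extendFrom_nonreal_eventuallyEq hH hfH).symm
  · exact (hf w h).congr (hloc w h).symm

end Extension

/-! ### Local factorization of `e^C` and the sign of `C'`. -/

section Local

/-- The measure `μ` agrees on `(t₂, t₁)` with the restriction of Lebesgue measure to `(c, d)`. -/
structure IsLocallyFlat (μ : Measure ℝ) (t₂ t₁ c d : ℝ) : Prop where
  left_le : t₂ ≤ c
  le : c ≤ d
  le_right : d ≤ t₁
  restrict_eq : μ.restrict (Ioo t₂ t₁) = volume.restrict (Ioo c d)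

/-- The continuation of `e^C` across `(t₂, t₁)`. -/
def localExp (μ : Measure ℝ) (a b t₂ t₁ c d : ℝ) (w : ℂ) : ℂ :=
  Complex.exp (cauchyOn μ (Icc a b \ Ioo t₂ t₁) w) * ((w - c) / (w - d))

/-- The continuation of `C'` across `(t₂, t₁)`. -/
def localDeriv (μ : Measure ℝ) (a b t₂ t₁ c d : ℝ) (w : ℂ) : ℂ :=
  deriv (cauchyOn μ (Icc a b \ Ioo t₂ t₁)) w + (1 / (w - c) - 1 / (w - d))

variable {μ : Measure ℝ} {a b t₂ t₁ c d t : ℝ}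

theorem measurableSet_Icc_diff_Ioo : MeasurableSet (Icc a b \ Ioo t₂ t₁) :=
  measurableSet_Icc.diff measurableSet_Ioo

theorem isClosed_Icc_diff_Ioo : IsClosed (Icc a b \ Ioo t₂ t₁) :=
  isClosed_Icc.sdiff isOpen_Ioo

theorem ofReal_mem_compl_image (ht : t ∈ Ioo t₂ t₁) :
    (t : ℂ) ∈ (((↑) : ℝ → ℂ) '' (Icc a b \ Ioo t₂ t₁))ᶜ := by
  rintro ⟨x, hx, hxt⟩
  exact hx.2 (Complex.ofReal_injective hxt ▸ ht)

theorem hasDerivAt_cauchyOn_diff [IsFiniteMeasure μ] {w : ℂ}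
    (hw : w ∈ (((↑) : ℝ → ℂ) '' (Icc a b \ Ioo t₂ t₁))ᶜ) :
    HasDerivAt (cauchyOn μ (Icc a b \ Ioo t₂ t₁))
      (∫ x in Icc a b \ Ioo t₂ t₁, -1 / (w - (x : ℂ)) ^ 2 ∂μ) w :=
  hasDerivAt_cauchyOn isClosed_Icc_diff_Ioo (by simp) measurableSet_Icc_diff_Ioo hw

theorem analyticAt_cauchyOn_diff [IsFiniteMeasure μ] {w : ℂ}
    (hw : w ∈ (((↑) : ℝ → ℂ) '' (Icc a b \ Ioo t₂ t₁))ᶜ) :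
    AnalyticAt ℂ (cauchyOn μ (Icc a b \ Ioo t₂ t₁)) w :=
  analyticAt_cauchyOn isClosed_Icc_diff_Ioo (by simp) measurableSet_Icc_diff_Ioo hw

theorem cauchy_eq_of_isLocallyFlat [IsFiniteMeasure μ] (hc : μ (Icc a b)ᶜ = 0)
    (h : IsLocallyFlat μ t₂ t₁ c d) {w : ℂ} (hw : IntegrableOn (fun x : ℝ => 1 / (w - (x : ℂ)))
      (Icc a b) μ) :
    cauchy μ a b w =
      cauchyOn μ (Icc a b \ Ioo t₂ t₁) w + ∫ x in c..d, 1 / (w - (x : ℂ)) := by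
  have h1 := integral_inter_add_sdiff (μ := μ) (t := Ioo t₂ t₁) measurableSet_Ioo hw
  have h2 : (Icc a b ∩ Ioo t₂ t₁ : Set ℝ) =ᵐ[μ] Ioo t₂ t₁ := by
    have : ∀ᵐ x ∂μ, x ∈ Icc a b := hc
    filter_upwards [this] with x hx
    exact propext ⟨fun hx' => hx'.2, fun hx' => ⟨hx, hx'⟩⟩
  rw [setIntegral_congr_set h2, h.restrict_eq] at h1
  rw [intervalIntegral.integral_of_le h.le, integral_Ioc_eq_integral_Ioo, add_comm]
  exact h1.symm

theorem cauchy_eq_of_nonreal [IsFiniteMeasure μ] (hc : μ (Icc a b)ᶜ = 0)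
    (h : IsLocallyFlat μ t₂ t₁ c d) {w : ℂ} (hw : w ∈ nonreal) :
    cauchy μ a b w = cauchyOn μ (Icc a b \ Ioo t₂ t₁) w +
      (Complex.log (w - c) - Complex.log (w - d)) := by
  rw [cauchy_eq_of_isLocallyFlat hc h
    (integrableOn_Icc_of_continuous (continuous_kernel hw) a b), intervalIntegral_kernel hw]

theorem exp_cauchy_eq_localExp [IsFiniteMeasure μ] (hc : μ (Icc a b)ᶜ = 0)
    (h : IsLocallyFlat μ t₂ t₁ c d) {w : ℂ} (hw : w ∈ nonreal) :
    Complex.exp (cauchy μ a b w) = localExp μ a b t₂ t₁ c d w := by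
  rw [cauchy_eq_of_isLocallyFlat hc h
    (integrableOn_Icc_of_continuous (continuous_kernel hw) a b), Complex.exp_add,
    exp_intervalIntegral_kernel hw, localExp]

theorem deriv_cauchy_eq_localDeriv [IsFiniteMeasure μ] (hc : μ (Icc a b)ᶜ = 0)
    (h : IsLocallyFlat μ t₂ t₁ c d) {w : ℂ} (hw : w ∈ nonreal) :
    deriv (cauchy μ a b) w = localDeriv μ a b t₂ t₁ c d w := by
  have h1 : cauchy μ a b =ᶠ[𝓝 w] fun w => cauchyOn μ (Icc a b \ Ioo t₂ t₁) w +
      (Complex.log (w - c) - Complex.log (w - d)) := by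
    filter_upwards [isOpen_nonreal.mem_nhds hw] with z hz
    exact cauchy_eq_of_nonreal hc h hz
  have hlog : ∀ r : ℝ, HasDerivAt (fun w : ℂ => Complex.log (w - r)) (1 / (w - r)) w := by
    intro r
    refine ((hasDerivAt_id w).sub_const (r : ℂ)).clog (Or.inr ?_)
    simpa using (show w.im ≠ 0 from hw)
  rw [h1.deriv_eq]
  have h2 := (analyticAt_cauchyOn_diff (μ := μ) (a := a) (b := b) (t₂ := t₂) (t₁ := t₁)
    (mem_compl_ofReal_image_of_nonreal hw _)).differentiableAt.hasDerivAt
  exact (h2.add ((hlog c).sub (hlog d))).deriv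

theorem hasDerivAt_localExp [IsFiniteMeasure μ] (ht : t ∈ Ioo t₂ t₁) (htc : t ≠ c) (htd : t ≠ d) :
    HasDerivAt (localExp μ a b t₂ t₁ c d)
      (localExp μ a b t₂ t₁ c d t * localDeriv μ a b t₂ t₁ c d t) t := by
  have hc0 : (t : ℂ) - c ≠ 0 := sub_ne_zero.2 fun h => htc (Complex.ofReal_injective h)
  have hd0 : (t : ℂ) - d ≠ 0 := sub_ne_zero.2 fun h => htd (Complex.ofReal_injective h)
  have h1 := (analyticAt_cauchyOn_diff (μ := μ) (a := a) (b := b)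
    (ofReal_mem_compl_image ht)).differentiableAt.hasDerivAt
  have h2 := h1.cexp.mul (((hasDerivAt_id (t : ℂ)).sub_const (c : ℂ)).div
    ((hasDerivAt_id (t : ℂ)).sub_const (d : ℂ)) hd0)
  refine h2.congr_deriv ?_
  simp only [localExp, localDeriv, Pi.div_apply, id]
  field_simp

theorem analyticAt_localExp [IsFiniteMeasure μ] (ht : t ∈ Ioo t₂ t₁) (htd : t ≠ d) :
    AnalyticAt ℂ (localExp μ a b t₂ t₁ c d) t := by
  have hd0 : (t : ℂ) - d ≠ 0 := sub_ne_zero.2 fun h => htd (Complex.ofReal_injective h)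
  exact (analyticAt_cauchyOn_diff (ofReal_mem_compl_image ht)).cexp.mul
    ((analyticAt_id.sub analyticAt_const).div (analyticAt_id.sub analyticAt_const) hd0)

theorem analyticAt_localDeriv [IsFiniteMeasure μ] (ht : t ∈ Ioo t₂ t₁) (htc : t ≠ c)
    (htd : t ≠ d) : AnalyticAt ℂ (localDeriv μ a b t₂ t₁ c d) t := by
  have hc0 : (t : ℂ) - c ≠ 0 := sub_ne_zero.2 fun h => htc (Complex.ofReal_injective h)
  have hd0 : (t : ℂ) - d ≠ 0 := sub_ne_zero.2 fun h => htd (Complex.ofReal_injective h)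
  exact (analyticAt_cauchyOn_diff (ofReal_mem_compl_image ht)).deriv.add
    ((analyticAt_const.div (analyticAt_id.sub analyticAt_const) hc0).sub
      (analyticAt_const.div (analyticAt_id.sub analyticAt_const) hd0))

theorem localExp_ne_zero (htc : t ≠ c) (htd : t ≠ d) : localExp μ a b t₂ t₁ c d t ≠ 0 := by
  have hc0 : (t : ℂ) - c ≠ 0 := sub_ne_zero.2 fun h => htc (Complex.ofReal_injective h)
  have hd0 : (t : ℂ) - d ≠ 0 := sub_ne_zero.2 fun h => htd (Complex.ofReal_injective h)
  exact mul_ne_zero (Complex.exp_ne_zero _) (div_ne_zero hc0 hd0)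

theorem localDeriv_ofReal [IsFiniteMeasure μ] (ht : t ∈ Ioo t₂ t₁) :
    localDeriv μ a b t₂ t₁ c d t =
      ((-∫ x in Icc a b \ Ioo t₂ t₁, 1 / (t - x) ^ 2 ∂μ) + (1 / (t - c) - 1 / (t - d)) : ℝ) := by
  rw [localDeriv, (hasDerivAt_cauchyOn_diff (ofReal_mem_compl_image ht)).deriv]
  push_cast
  congr 1
  rw [← Complex.ofReal_neg, ← integral_neg]
  refine (integral_congr_ae (Eventually.of_forall fun x => ?_)).trans
    ((integral_ofReal (𝕜 := ℂ) (f := fun x : ℝ => -(1 / (t - x) ^ 2))).trans ?_)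
  · change _ = ((-(1 / (t - x) ^ 2) : ℝ) : ℂ)
    push_cast
    ring
  · rfl

theorem continuousOn_inv_sq {s : Set ℝ} (hs : t ∉ s) :
    ContinuousOn (fun x : ℝ => 1 / (t - x) ^ 2) s :=
  continuousOn_const.div (by fun_prop) fun x hx =>
    pow_ne_zero 2 (sub_ne_zero.2 fun h => hs (h ▸ hx))

theorem integrableOn_inv_sq {m : Measure ℝ} [IsLocallyFiniteMeasure m] {s : Set ℝ}
    (hs : IsCompact s) (ht : t ∉ s) : IntegrableOn (fun x : ℝ => 1 / (t - x) ^ 2) s m :=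
  (continuousOn_inv_sq ht).integrableOn_compact hs

theorem isCompact_Icc_diff_Ioo : IsCompact (Icc a b \ Ioo t₂ t₁) :=
  isCompact_Icc.diff isOpen_Ioo

theorem integral_inv_sq_pos [IsFiniteMeasure μ] (ht : t ∈ Ioo t₂ t₁)
    (hpos : 0 < μ (Icc a b \ Ioo t₂ t₁)) :
    0 < ∫ x in Icc a b \ Ioo t₂ t₁, 1 / (t - x) ^ 2 ∂μ := by
  rw [setIntegral_pos_iff_support_of_nonneg_ae]
  · refine hpos.trans_le (measure_mono fun x hx => ⟨?_, hx⟩)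
    have : t - x ≠ 0 := sub_ne_zero.2 fun h => hx.2 (h ▸ ht)
    exact one_div_ne_zero (pow_ne_zero 2 this)
  · exact Eventually.of_forall fun x => by positivity
  · exact integrableOn_inv_sq isCompact_Icc_diff_Ioo fun h => h.2 ht

theorem intervalIntegral_inv_sq {u v : ℝ} (h : t ∉ uIcc u v) :
    ∫ x in u..v, 1 / (t - x) ^ 2 = 1 / (t - v) - 1 / (t - u) := by
  refine intervalIntegral.integral_eq_sub_of_hasDerivAt (f := fun x => 1 / (t - x))
    (fun x hx => ?_) (continuousOn_inv_sq h).intervalIntegrable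
  have hne : t - x ≠ 0 := sub_ne_zero.2 fun h' => h (h' ▸ hx)
  simpa [one_div] using ((hasDerivAt_id x).const_sub t).fun_inv hne

/-- The right side is the Lebesgue integral of `1/(t - x)²` over the whole complement of `(t₂, t₁)`.
The set `[a,b]` sees only a bounded part of it, so the inequality is strict even when `μ = λ` on
that part. -/
theorem integral_inv_sq_lt [IsFiniteMeasure μ] (hle : μ ≤ volume) (ht : t ∈ Ioo t₂ t₁) :
    ∫ x in Icc a b \ Ioo t₂ t₁, 1 / (t - x) ^ 2 ∂μ < 1 / (t - t₂) - 1 / (t - t₁) := by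
  set a' := min a t₂ with ha'
  set b' := max b t₁ with hb'
  have h1 : a' ≤ t₂ := min_le_right _ _
  have h2 : t₁ ≤ b' := le_max_right _ _
  have n1 : t ∉ Icc a' t₂ := fun h => absurd h.2 (not_le.2 ht.1)
  have n2 : t ∉ Icc t₁ b' := fun h => absurd h.1 (not_le.2 ht.2)
  have i1 := integrableOn_inv_sq (m := volume) (isCompact_Icc (a := a') (b := t₂)) n1
  have i2 := integrableOn_inv_sq (m := volume) (isCompact_Icc (a := t₁) (b := b')) n2
  have hsub : Icc a b \ Ioo t₂ t₁ ⊆ Icc a' t₂ ∪ Icc t₁ b' := by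
    intro x hx
    rcases le_or_gt x t₂ with h | h
    · exact Or.inl ⟨(min_le_left _ _).trans hx.1.1, h⟩
    · exact Or.inr ⟨not_lt.1 fun h' => hx.2 ⟨h, h'⟩, hx.1.2.trans (le_max_left _ _)⟩
  have hdisj : Disjoint (Icc a' t₂) (Icc t₁ b') := by
    rw [Set.disjoint_left]
    intro x hx hx'
    linarith [hx.2, hx'.1, ht.1, ht.2]
  have hmono : ∫ x in Icc a b \ Ioo t₂ t₁, 1 / (t - x) ^ 2 ∂μ ≤
      ∫ x in Icc a' t₂ ∪ Icc t₁ b', 1 / (t - x) ^ 2 :=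
    integral_mono_measure (Measure.restrict_mono hsub hle)
      (Eventually.of_forall fun x => by positivity) (i1.union i2)
  rw [setIntegral_union hdisj measurableSet_Icc i1 i2, integral_Icc_eq_integral_Ioc,
    integral_Icc_eq_integral_Ioc, ← intervalIntegral.integral_of_le h1,
    ← intervalIntegral.integral_of_le h2, intervalIntegral_inv_sq (by rwa [uIcc_of_le h1]),
    intervalIntegral_inv_sq (by rwa [uIcc_of_le h2])] at hmono
  have p1 : 0 < 1 / (t - a') := one_div_pos.2 (by linarith [ht.1])
  have p2 : 1 / (t - b') < 0 := one_div_neg.2 (by linarith [ht.2])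
  linarith

end Local

/-! ### Limits of the liquid point at a regular point, a zero or a pole of `e^C`. -/

section Limits

variable {μ : Measure ℝ} {a b t : ℝ}

theorem tendsto_star_nhdsWithin (t : ℝ) :
    Tendsto (fun w : ℂ => star w) (𝓝[upperHalf] (t : ℂ)) (𝓝 (t : ℂ)) := by
  have h := continuous_star.tendsto (t : ℂ)
  have hx : star (t : ℂ) = (t : ℂ) := Complex.conj_ofReal t
  rw [hx] at h
  exact h.mono_left nhdsWithin_le_nhds

/-- Both endpoints of the slope move to `t`, so strict differentiability is needed; the derivative
at `t` alone would not suffice. -/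
theorem tendsto_slope_star {H : ℂ → ℂ} {H' : ℂ} (hH : HasStrictDerivAt H H' (t : ℂ)) :
    Tendsto (fun w => (H w - H (star w)) / (w - star w)) (𝓝[upperHalf] (t : ℂ)) (𝓝 H') := by
  have h1 : Tendsto (fun w : ℂ => (w, star w)) (𝓝[upperHalf] (t : ℂ)) (𝓝 ((t : ℂ), (t : ℂ))) :=
    (tendsto_id.mono_left nhdsWithin_le_nhds).prodMk_nhds (tendsto_star_nhdsWithin t)
  have h2 := (hH.isLittleO.comp_tendsto h1).tendsto_div_nhds_zero
  have h3 := h2.add_const H'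
  rw [zero_add] at h3
  refine h3.congr' ?_
  filter_upwards [self_mem_nhdsWithin] with w hw
  have hne : w - star w ≠ 0 := by
    rw [← neg_sub]; exact neg_ne_zero.2 (star_sub_ne_zero (upperHalf_subset_nonreal hw))
  simp only [Function.comp_apply, ContinuousLinearMap.toSpanSingleton_apply, smul_eq_mul]
  field_simp
  ring

theorem eventually_star {P : ℂ → Prop} (h : ∀ᶠ z in 𝓝 (t : ℂ), z ∈ nonreal → P z) :
    ∀ᶠ w in 𝓝[upperHalf] (t : ℂ), P w ∧ P (star w) := by
  filter_upwards [self_mem_nhdsWithin, nhdsWithin_le_nhds h, tendsto_star_nhdsWithin t h]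
    with w hw h1 h2
  have hn := upperHalf_subset_nonreal hw
  exact ⟨h1 hn, h2 (star_mem_nonreal hn)⟩

theorem tendsto_chiLC_etaLC {H : ℂ → ℂ} {H' : ℂ} (hH : HasStrictDerivAt H H' (t : ℂ))
    (h0 : H' ≠ 0)
    (h : ∀ᶠ z in 𝓝 (t : ℂ), z ∈ nonreal → Complex.exp (cauchy μ a b z) = H z) :
    Tendsto (chiLC μ a b) (𝓝[upperHalf] (t : ℂ)) (𝓝 (t + (H t - 1) / H')) ∧
      Tendsto (etaLC μ a b) (𝓝[upperHalf] (t : ℂ)) (𝓝 (1 + (H t - 1) ^ 2 / H')) := by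
  have hs := tendsto_slope_star hH
  have hid : Tendsto (fun w : ℂ => w) (𝓝[upperHalf] (t : ℂ)) (𝓝 (t : ℂ)) :=
    tendsto_id.mono_left nhdsWithin_le_nhds
  have hHt := hH.hasDerivAt.continuousAt.tendsto
  have h1 : Tendsto (fun w => H w) (𝓝[upperHalf] (t : ℂ)) (𝓝 (H t)) := hHt.comp hid
  have h2 : Tendsto (fun w => H (star w)) (𝓝[upperHalf] (t : ℂ)) (𝓝 (H t)) :=
    hHt.comp (tendsto_star_nhdsWithin t)
  constructor
  · refine (hid.add ((h2.sub_const 1).div hs h0)).congr' ?_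
    filter_upwards [eventually_star h, self_mem_nhdsWithin] with w hw hwu
    have hne := star_sub_ne_zero (upperHalf_subset_nonreal hwu)
    have hne' : w - star w ≠ 0 := by rw [← neg_sub]; exact neg_ne_zero.2 hne
    simp only [Pi.div_apply]
    rw [chiLC, hw.1, hw.2, div_div_eq_mul_div, mul_comm (H (star w) - 1)]
  · have h3 := (((h1.sub_const 1).mul (h2.sub_const 1)).div hs h0).const_add 1
    rw [← sq] at h3
    refine h3.congr' ?_
    filter_upwards [eventually_star h, self_mem_nhdsWithin] with w hw hwu
    simp only [Pi.div_apply]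
    rw [etaLC, hw.1, hw.2, div_div_eq_mul_div]
    ring

theorem tendsto_chiLC_etaLC_of_pole {B : ℂ → ℂ} {B' : ℂ} (hB : HasStrictDerivAt B B' (t : ℂ))
    (h0 : B t ≠ 0)
    (h : ∀ᶠ z in 𝓝 (t : ℂ), z ∈ nonreal → Complex.exp (cauchy μ a b z) = B z / (z - t)) :
    Tendsto (chiLC μ a b) (𝓝[upperHalf] (t : ℂ)) (𝓝 (t : ℂ)) ∧
      Tendsto (etaLC μ a b) (𝓝[upperHalf] (t : ℂ)) (𝓝 (1 - B t)) := by
  have hs := tendsto_slope_star hB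
  have hid : Tendsto (fun w : ℂ => w) (𝓝[upperHalf] (t : ℂ)) (𝓝 (t : ℂ)) :=
    tendsto_id.mono_left nhdsWithin_le_nhds
  have hBt := hB.hasDerivAt.continuousAt.tendsto
  have h1 : Tendsto (fun w => B w) (𝓝[upperHalf] (t : ℂ)) (𝓝 (B t)) := hBt.comp hid
  have h2 : Tendsto (fun w => B (star w)) (𝓝[upperHalf] (t : ℂ)) (𝓝 (B t)) :=
    hBt.comp (tendsto_star_nhdsWithin t)
  have hz : Tendsto (fun w : ℂ => w - t) (𝓝[upperHalf] (t : ℂ)) (𝓝 0) := by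
    simpa using hid.sub_const (t : ℂ)
  have hz' : Tendsto (fun w : ℂ => star w - t) (𝓝[upperHalf] (t : ℂ)) (𝓝 0) := by
    simpa using (tendsto_star_nhdsWithin t).sub_const (t : ℂ)
  -- This is what remains of `e^{C(w)} - e^{C(w̄)}` after removing `(w - w̄)/((w - t)(w̄ - t))`. It
  -- has the nonzero limit `-B t`.
  have hden : Tendsto (fun w => -B w + (B w - B (star w)) / (w - star w) * (w - t))
      (𝓝[upperHalf] (t : ℂ)) (𝓝 (-B t)) := by
    simpa using h1.neg.add (hs.mul hz)
  have hfact : ∀ᶠ w in 𝓝[upperHalf] (t : ℂ),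
      B w / (w - t) - B (star w) / (star w - t) =
        (w - star w) * (-B w + (B w - B (star w)) / (w - star w) * (w - t)) /
          ((w - t) * (star w - t)) := by
    filter_upwards [self_mem_nhdsWithin] with w hwu
    have hn := upperHalf_subset_nonreal hwu
    have hne := star_sub_ne_zero hn
    have hne' : w - star w ≠ 0 := by rw [← neg_sub]; exact neg_ne_zero.2 hne
    have k1 := sub_ofReal_ne_zero hn t
    have k2 := sub_ofReal_ne_zero (star_mem_nonreal hn) t
    field_simp
    ring
  have hden0 : ∀ᶠ w in 𝓝[upperHalf] (t : ℂ),
      -B w + (B w - B (star w)) / (w - star w) * (w - t) ≠ 0 :=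
    hden.eventually_ne (neg_ne_zero.2 h0)
  constructor
  · have h3 := hid.add (((h2.sub hz').mul hz).div hden (neg_ne_zero.2 h0))
    simp only [mul_zero, zero_div, add_zero] at h3
    refine h3.congr' ?_
    filter_upwards [eventually_star h, self_mem_nhdsWithin, hfact, hden0] with w hw hwu hf hd
    have hn := upperHalf_subset_nonreal hwu
    have hne' : w - star w ≠ 0 := by rw [← neg_sub]; exact neg_ne_zero.2 (star_sub_ne_zero hn)
    have k1 := sub_ofReal_ne_zero hn t
    have k2 := sub_ofReal_ne_zero (star_mem_nonreal hn) t
    simp only [Pi.div_apply]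
    rw [chiLC, hw.1, hw.2, hf]
    generalize -B w + (B w - B (star w)) / (w - star w) * (w - t) = D at *
    field_simp
  · have h3 := (((h1.sub hz).mul (h2.sub hz')).div hden (neg_ne_zero.2 h0)).const_add 1
    have h4 : 1 + (B t - 0) * (B t - 0) / -B t = 1 - B t := by
      field_simp
      ring
    rw [h4] at h3
    refine h3.congr' ?_
    filter_upwards [eventually_star h, self_mem_nhdsWithin, hfact, hden0] with w hw hwu hf hd
    have hn := upperHalf_subset_nonreal hwu
    have hne' : w - star w ≠ 0 := by rw [← neg_sub]; exact neg_ne_zero.2 (star_sub_ne_zero hn)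
    have k1 := sub_ofReal_ne_zero hn t
    have k2 := sub_ofReal_ne_zero (star_mem_nonreal hn) t
    simp only [Pi.div_apply]
    rw [etaLC, hw.1, hw.2, hf]
    generalize -B w + (B w - B (star w)) / (w - star w) * (w - t) = D at *
    field_simp

theorem ofReal_of_tendsto {f : ℂ → ℂ} {g : ℂ → ℝ} {X : ℂ}
    (hf : Tendsto f (𝓝[upperHalf] (t : ℂ)) (𝓝 X)) (hg : ∀ w ∈ upperHalf, (g w : ℂ) = f w) :
    ((X.re : ℝ) : ℂ) = X := by
  refine Complex.ext (by simp) ?_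
  rw [Complex.ofReal_im]
  refine tendsto_nhds_unique ?_ ((Complex.continuous_im.tendsto X).comp hf)
  refine tendsto_const_nhds.congr' ?_
  filter_upwards [self_mem_nhdsWithin] with w hw
  rw [Function.comp_apply, ← hg w hw, Complex.ofReal_im]

theorem tendsto_liquidPoint {X Y : ℂ} {l : Filter ℂ}
    (hX : Tendsto (chiLC μ a b) l (𝓝 X)) (hY : Tendsto (etaLC μ a b) l (𝓝 Y)) :
    Tendsto (liquidPoint μ a b) l (𝓝 (X.re, Y.re)) :=
  ((Complex.continuous_re.tendsto X).comp hX).prodMk_nhds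
    ((Complex.continuous_re.tendsto Y).comp hY)

end Limits

/-! ### Flat neighbourhoods of the points of `R`. -/

section Flat

variable {μ : Measure ℝ} {t t₂ t₁ : ℝ}

theorem isLocallyFlat_of_subset_voidSet (h : t₂ ≤ t₁) (hI : Ioo t₂ t₁ ⊆ voidSet μ) :
    IsLocallyFlat μ t₂ t₁ t₂ t₂ where
  left_le := le_rfl
  le := le_rfl
  le_right := h
  restrict_eq := by
    rw [Measure.restrict_eq_zero.2 (measure_eq_zero_of_subset_voidSet hI)]
    simp

theorem isLocallyFlat_of_subset_satSet [IsFiniteMeasure μ] (hle : μ ≤ volume) (h : t₂ ≤ t₁)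
    (hI : Ioo t₂ t₁ ⊆ satSet μ) : IsLocallyFlat μ t₂ t₁ t₂ t₁ :=
  ⟨le_rfl, h, le_rfl, restrict_eq_of_subset_satSet hle hI⟩

theorem measure_singleton_eq_zero (hle : μ ≤ volume) (x : ℝ) : μ {x} = 0 :=
  le_antisymm ((hle {x}).trans (by simp)) (zero_le)

/-- The right endpoint of the Lebesgue piece is `t` itself, so the factor `(w - t₂)/(w - t)` has a
pole at `t`. For `IsInterval2` the left endpoint is `t`, which gives a zero. -/
theorem IsInterval1.isLocallyFlat [IsFiniteMeasure μ] (hle : μ ≤ volume)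
    (h : IsInterval1 μ t t₂ t₁) : IsLocallyFlat μ t₂ t₁ t₂ t where
  left_le := le_rfl
  le := h.1.1.le
  le_right := h.1.2.le
  restrict_eq := by
    rw [← restrict_eq_of_subset_satSet hle h.2.2]
    refine Measure.restrict_congr_set ?_
    have h0 : μ ({t} ∪ Ioo t t₁) = 0 := measure_union_null (measure_singleton_eq_zero hle t)
      (measure_eq_zero_of_subset_voidSet h.2.1)
    have h1 : ∀ᵐ x ∂μ, x ∉ {t} ∪ Ioo t t₁ := measure_eq_zero_iff_ae_notMem.1 h0
    filter_upwards [h1] with x hx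
    refine propext ⟨fun hx' => ⟨hx'.1, ?_⟩, fun hx' => ⟨hx'.1, hx'.2.trans h.1.2⟩⟩
    by_contra! hxt
    rcases hxt.eq_or_lt with rfl | hlt
    · exact hx (Or.inl rfl)
    · exact hx (Or.inr ⟨hlt, hx'.2⟩)

theorem IsInterval2.isLocallyFlat [IsFiniteMeasure μ] (hle : μ ≤ volume)
    (h : IsInterval2 μ t t₂ t₁) : IsLocallyFlat μ t₂ t₁ t t₁ where
  left_le := h.1.1.le
  le := h.1.2.le
  le_right := le_rfl
  restrict_eq := by
    rw [← restrict_eq_of_subset_satSet hle h.2.1]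
    refine Measure.restrict_congr_set ?_
    have h0 : μ ({t} ∪ Ioo t₂ t) = 0 := measure_union_null (measure_singleton_eq_zero hle t)
      (measure_eq_zero_of_subset_voidSet h.2.2)
    have h1 : ∀ᵐ x ∂μ, x ∉ {t} ∪ Ioo t₂ t := measure_eq_zero_iff_ae_notMem.1 h0
    filter_upwards [h1] with x hx
    refine propext ⟨fun hx' => ⟨?_, hx'.2⟩, fun hx' => ⟨h.1.1.trans hx'.1, hx'.2⟩⟩
    by_contra! hxt
    rcases hxt.eq_or_lt with rfl | hlt
    · exact hx (Or.inl rfl)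
    · exact hx (Or.inr ⟨hx'.1, hlt⟩)

theorem exists_isLocallyFlat_of_mem_voidSet [IsProbabilityMeasure μ] {a b : ℝ}
    (hc : μ (Icc a b)ᶜ = 0) (ht : t ∈ voidSet μ) :
    ∃ t₂ t₁ c : ℝ, t ∈ Ioo t₂ t₁ ∧ IsLocallyFlat μ t₂ t₁ c c ∧ t ≠ c ∧
      localDeriv μ a b t₂ t₁ c c t ≠ 0 := by
  obtain ⟨t₂, t₁, htI, hI⟩ :=
    mem_nhds_iff_exists_Ioo_subset.1 (Measure.isOpen_compl_support.mem_nhds ht)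
  -- The Lebesgue piece is empty; any `c` in `[t₂, t₁]` other than `t` would serve for it.
  refine ⟨t₂, t₁, t₂, htI, isLocallyFlat_of_subset_voidSet (htI.1.trans htI.2).le hI, htI.1.ne', ?_⟩
  rw [localDeriv_ofReal htI, Complex.ofReal_ne_zero, sub_self, add_zero, neg_ne_zero]
  refine (integral_inv_sq_pos htI (pos_iff_ne_zero.2 fun h0 => ?_)).ne'
  have h1 : μ univ = 0 := by
    refine measure_mono_null (t := (Icc a b)ᶜ ∪ (Icc a b \ Ioo t₂ t₁ ∪ Ioo t₂ t₁)) ?_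
      (measure_union_null hc (measure_union_null h0 (measure_eq_zero_of_subset_voidSet hI)))
    intro x _
    by_cases hx : x ∈ Icc a b <;> by_cases hx' : x ∈ Ioo t₂ t₁ <;> simp_all
  simp at h1

theorem exists_isLocallyFlat_of_mem_satSet [IsFiniteMeasure μ] {a b : ℝ} (hle : μ ≤ volume)
    (ht : t ∈ satSet μ) :
    ∃ t₂ t₁ : ℝ, t ∈ Ioo t₂ t₁ ∧ IsLocallyFlat μ t₂ t₁ t₂ t₁ ∧
      localDeriv μ a b t₂ t₁ t₂ t₁ t ≠ 0 := by
  obtain ⟨t₂, t₁, htI, hI⟩ :=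
    mem_nhds_iff_exists_Ioo_subset.1 (Measure.isOpen_compl_support.mem_nhds ht)
  refine ⟨t₂, t₁, htI, isLocallyFlat_of_subset_satSet hle (htI.1.trans htI.2).le hI, ?_⟩
  rw [localDeriv_ofReal htI, Complex.ofReal_ne_zero]
  have := integral_inv_sq_lt (a := a) (b := b) hle htI
  exact (by linarith : (0 : ℝ) < _).ne'

theorem exists_isLocallyFlat [IsProbabilityMeasure μ] {a b : ℝ} (hle : μ ≤ volume)
    (hc : μ (Icc a b)ᶜ = 0) (ht : t ∈ voidSet μ ∪ satSet μ) :
    ∃ t₂ t₁ c d : ℝ, t ∈ Ioo t₂ t₁ ∧ IsLocallyFlat μ t₂ t₁ c d ∧ t ≠ c ∧ t ≠ d ∧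
      localDeriv μ a b t₂ t₁ c d t ≠ 0 := by
  rcases ht with ht | ht
  · obtain ⟨t₂, t₁, c, htI, hf, hne, h0⟩ := exists_isLocallyFlat_of_mem_voidSet hc ht
    exact ⟨t₂, t₁, c, c, htI, hf, hne, hne, h0⟩
  · obtain ⟨t₂, t₁, htI, hf, h0⟩ := exists_isLocallyFlat_of_mem_satSet hle ht
    exact ⟨t₂, t₁, t₂, t₁, htI, hf, htI.1.ne', htI.2.ne, h0⟩

end Flat

/-! ### The edge curve as boundary values of the liquid map. -/

section Edge

variable {μ : Measure ℝ} [IsProbabilityMeasure μ] {a b t t₂ t₁ c d : ℝ}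

theorem expC_eventuallyEq (hc : μ (Icc a b)ᶜ = 0) (ht : t ∈ Ioo t₂ t₁)
    (hf : IsLocallyFlat μ t₂ t₁ c d) (htd : t ≠ d) :
    expC μ a b =ᶠ[𝓝 (t : ℂ)] localExp μ a b t₂ t₁ c d :=
  extendFrom_nonreal_eventuallyEq (analyticAt_localExp ht htd)
    (Eventually.of_forall fun _ hz => exp_cauchy_eq_localExp hc hf hz)

theorem derivC_eventuallyEq (hc : μ (Icc a b)ᶜ = 0) (ht : t ∈ Ioo t₂ t₁)
    (hf : IsLocallyFlat μ t₂ t₁ c d) (htc : t ≠ c) (htd : t ≠ d) :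
    derivC μ a b =ᶠ[𝓝 (t : ℂ)] localDeriv μ a b t₂ t₁ c d :=
  extendFrom_nonreal_eventuallyEq (analyticAt_localDeriv ht htc htd)
    (Eventually.of_forall fun _ hz => deriv_cauchy_eq_localDeriv hc hf hz)

theorem isAnalyticExtension_expC {S : Set ℝ} (hle : μ ≤ volume) (hc : μ (Icc a b)ᶜ = 0)
    (hS : Sᶜ ⊆ voidSet μ ∪ satSet μ) :
    IsAnalyticExtension (fun w => Complex.exp (cauchy μ a b w)) (expC μ a b) S := by
  refine isAnalyticExtension_extendFrom (fun w hw => (analyticAt_cauchy hw).cexp) fun t ht => ?_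
  obtain ⟨t₂, t₁, c, d, htI, hf, _, htd, _⟩ := exists_isLocallyFlat (a := a) hle hc (hS ht)
  exact ⟨_, analyticAt_localExp htI htd,
    Eventually.of_forall fun _ hz => exp_cauchy_eq_localExp hc hf hz⟩

theorem isAnalyticExtension_derivC {S : Set ℝ} (hle : μ ≤ volume) (hc : μ (Icc a b)ᶜ = 0)
    (hS : Sᶜ ⊆ voidSet μ ∪ satSet μ) :
    IsAnalyticExtension (deriv (cauchy μ a b)) (derivC μ a b) S := by
  refine isAnalyticExtension_extendFrom (fun w hw => (analyticAt_cauchy hw).deriv) fun t ht => ?_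
  obtain ⟨t₂, t₁, c, d, htI, hf, htc, htd, _⟩ := exists_isLocallyFlat (a := a) hle hc (hS ht)
  exact ⟨_, analyticAt_localDeriv htI htc htd,
    Eventually.of_forall fun _ hz => deriv_cauchy_eq_localDeriv hc hf hz⟩

theorem expC_derivC_of_mem_voidSet (ht : t ∈ voidSet μ) :
    expC μ a b t = Complex.exp (cauchy μ a b t) ∧
      derivC μ a b t = deriv (cauchy μ a b) t := by
  have han : AnalyticAt ℂ (cauchy μ a b) (t : ℂ) := by
    refine analyticAt_cauchyOn (S := Icc a b) Measure.isClosed_support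
      (measure_mono_null (fun x hx => hx.2) Measure.measure_compl_support) measurableSet_Icc ?_
    rintro ⟨x, hx, hxt⟩
    exact ht (Complex.ofReal_injective hxt ▸ hx)
  exact ⟨(extendFrom_nonreal_eventuallyEq han.cexp
      (Eventually.of_forall fun _ _ => rfl)).eq_of_nhds,
    (extendFrom_nonreal_eventuallyEq han.deriv (Eventually.of_forall fun _ _ => rfl)).eq_of_nhds⟩

theorem expC_ne_zero_and_derivC_ne_zero (hle : μ ≤ volume) (hc : μ (Icc a b)ᶜ = 0)
    (ht : t ∈ voidSet μ ∪ satSet μ) : expC μ a b t ≠ 0 ∧ derivC μ a b t ≠ 0 := by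
  obtain ⟨t₂, t₁, c, d, htI, hf, htc, htd, h0⟩ := exists_isLocallyFlat (a := a) hle hc ht
  rw [(expC_eventuallyEq hc htI hf htd).eq_of_nhds,
    (derivC_eventuallyEq hc htI hf htc htd).eq_of_nhds]
  exact ⟨localExp_ne_zero htc htd, h0⟩

theorem tendsto_chiEC_etaEC (hle : μ ≤ volume) (hc : μ (Icc a b)ᶜ = 0)
    (ht : t ∈ voidSet μ ∪ satSet μ) :
    Tendsto (chiLC μ a b) (𝓝[upperHalf] (t : ℂ)) (𝓝 (chiEC μ a b t)) ∧
      Tendsto (etaLC μ a b) (𝓝[upperHalf] (t : ℂ)) (𝓝 (etaEC μ a b t)) := by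
  obtain ⟨t₂, t₁, c, d, htI, hf, htc, htd, h0⟩ := exists_isLocallyFlat (a := a) hle hc ht
  unfold chiEC etaEC
  rw [(expC_eventuallyEq hc htI hf htd).eq_of_nhds,
    (derivC_eventuallyEq hc htI hf htc htd).eq_of_nhds]
  have hstrict := (analyticAt_localExp (μ := μ) (a := a) (b := b) (c := c) htI htd).hasStrictDerivAt
  rw [(hasDerivAt_localExp htI htc htd).deriv] at hstrict
  exact tendsto_chiLC_etaLC hstrict (mul_ne_zero (localExp_ne_zero htc htd) h0)
    (Eventually.of_forall fun _ hz => exp_cauchy_eq_localExp hc hf hz)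

theorem cauchyOn_ofReal (μ : Measure ℝ) (a b t₂ t₁ t : ℝ) :
    cauchyOn μ (Icc a b \ Ioo t₂ t₁) t = (cauchyOff μ a b t₂ t₁ t : ℝ) := by
  unfold cauchyOn cauchyOff
  refine Eq.trans ?_ (integral_ofReal (𝕜 := ℂ) (f := fun x : ℝ => 1 / (t - x)))
  congr 1
  funext x
  change _ = ((1 / (t - x) : ℝ) : ℂ)
  push_cast
  rfl

theorem IsInterval1.tendsto_liquidPoint (hle : μ ≤ volume) (hc : μ (Icc a b)ᶜ = 0)
    (h : IsInterval1 μ t t₂ t₁) :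
    Tendsto (liquidPoint μ a b) (𝓝[upperHalf] (t : ℂ))
      (𝓝 (t, 1 - Real.exp (cauchyOff μ a b t₂ t₁ t) * (t - t₂))) := by
  let B : ℂ → ℂ := fun w => Complex.exp (cauchyOn μ (Icc a b \ Ioo t₂ t₁) w) * (w - t₂)
  have hB : AnalyticAt ℂ B t := (analyticAt_cauchyOn_diff (ofReal_mem_compl_image h.1)).cexp.mul
    (analyticAt_id.sub analyticAt_const)
  have hBt : B t = ((Real.exp (cauchyOff μ a b t₂ t₁ t) * (t - t₂) : ℝ) : ℂ) := by
    simp only [B, cauchyOn_ofReal]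
    push_cast
    rfl
  have hB0 : B t ≠ 0 := by
    rw [hBt, Complex.ofReal_ne_zero]
    exact mul_ne_zero (Real.exp_pos _).ne' (sub_ne_zero.2 h.1.1.ne')
  obtain ⟨h1, h2⟩ := tendsto_chiLC_etaLC_of_pole (μ := μ) (a := a) (b := b) hB.hasStrictDerivAt
    hB0 (Eventually.of_forall fun z hz => by
      rw [exp_cauchy_eq_localExp hc (h.isLocallyFlat hle) hz, localExp, mul_div_assoc])
  have h3 := GTEdge.tendsto_liquidPoint h1 h2
  rwa [hBt, ← Complex.ofReal_one, ← Complex.ofReal_sub, Complex.ofReal_re,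
    Complex.ofReal_re] at h3

theorem IsInterval2.tendsto_liquidPoint (hle : μ ≤ volume) (hc : μ (Icc a b)ᶜ = 0)
    (h : IsInterval2 μ t t₂ t₁) :
    Tendsto (liquidPoint μ a b) (𝓝[upperHalf] (t : ℂ))
      (𝓝 (t - Real.exp (-cauchyOff μ a b t₂ t₁ t) * (t - t₁),
        1 + Real.exp (-cauchyOff μ a b t₂ t₁ t) * (t - t₁))) := by
  have hd0 : (t : ℂ) - t₁ ≠ 0 := sub_ne_zero.2 fun h' => h.1.2.ne (Complex.ofReal_injective h')
  have hr0 : t - t₁ ≠ 0 := sub_ne_zero.2 h.1.2.ne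
  have hH := analyticAt_localExp (μ := μ) (a := a) (b := b) (c := t) h.1 h.1.2.ne
  have hHt : localExp μ a b t₂ t₁ t t₁ t = 0 := by simp [localExp]
  -- The continuation vanishes at `t`, so only the derivative of the factor `w - t` contributes.
  set H' : ℂ := Complex.exp (cauchyOff μ a b t₂ t₁ t) / (t - t₁) with hH'
  have hderiv : HasDerivAt (localExp μ a b t₂ t₁ t t₁) H' t := by
    have h1 := (analyticAt_cauchyOn_diff (μ := μ) (a := a) (b := b)
      (ofReal_mem_compl_image h.1)).differentiableAt.hasDerivAt
    have h2 := h1.cexp.mul (((hasDerivAt_id (t : ℂ)).sub_const (t : ℂ)).div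
      ((hasDerivAt_id (t : ℂ)).sub_const (t₁ : ℂ)) hd0)
    refine h2.congr_deriv ?_
    rw [hH', ← cauchyOn_ofReal]
    simp only [Pi.div_apply, id]
    field_simp
    ring
  have hstrict := hH.hasStrictDerivAt
  rw [hderiv.deriv] at hstrict
  obtain ⟨h1, h2⟩ := tendsto_chiLC_etaLC (μ := μ) (a := a) (b := b) hstrict
    (div_ne_zero (Complex.exp_ne_zero _) hd0)
    (Eventually.of_forall fun z hz => exp_cauchy_eq_localExp hc (h.isLocallyFlat hle) hz)
  have h3 := GTEdge.tendsto_liquidPoint h1 h2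
  have e1 : (t : ℂ) + (localExp μ a b t₂ t₁ t t₁ t - 1) / H' =
      ((t - Real.exp (-cauchyOff μ a b t₂ t₁ t) * (t - t₁) : ℝ) : ℂ) := by
    rw [hHt, hH']
    push_cast
    rw [Complex.exp_neg]
    field_simp
    ring
  have e2 : 1 + (localExp μ a b t₂ t₁ t t₁ t - 1) ^ 2 / H' =
      ((1 + Real.exp (-cauchyOff μ a b t₂ t₁ t) * (t - t₁) : ℝ) : ℂ) := by
    rw [hHt, hH']
    push_cast
    rw [Complex.exp_neg]
    field_simp
    ring
  rwa [e1, e2, Complex.ofReal_re, Complex.ofReal_re] at h3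

theorem tendsto_edgePoint (hle : μ ≤ volume) (hc : μ (Icc a b)ᶜ = 0) (ht : t ∈ R μ) :
    Tendsto (liquidPoint μ a b) (𝓝[upperHalf] (t : ℂ)) (𝓝 (edgePoint μ a b t)) := by
  unfold edgePoint
  split_ifs with h1 h2 h3
  · obtain ⟨hX, hY⟩ := tendsto_chiEC_etaEC hle hc h1
    exact tendsto_liquidPoint hX hY
  · exact h2.2.choose_spec.tendsto_liquidPoint hle hc
  · exact h3.2.choose_spec.tendsto_liquidPoint hle hc
  · rcases ht with (ht | ht) | ht
    · exact absurd ht h1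
    · exact absurd ht h2
    · exact absurd ht h3

theorem edgePoint_eq_of_mem_union (hle : μ ≤ volume) (hc : μ (Icc a b)ᶜ = 0) (hab : a ≤ b)
    (ht : t ∈ voidSet μ ∪ satSet μ) :
    ((edgePoint μ a b t).1 : ℂ) = chiEC μ a b t ∧
      ((edgePoint μ a b t).2 : ℂ) = etaEC μ a b t := by
  obtain ⟨hX, hY⟩ := tendsto_chiEC_etaEC hle hc ht
  unfold edgePoint
  rw [if_pos ht]
  exact ⟨ofReal_of_tendsto hX fun w hw => chiL_eq μ a b w (exp_cauchy_ne_star hle hc hab hw),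
    ofReal_of_tendsto hY fun w hw => etaL_eq μ a b w (exp_cauchy_ne_star hle hc hab hw)⟩

/-- The edge point is a limit of points of `L`. If it were interior it would be the image of some
`w₀` in the half plane, contradicting `not_tendsto_liquidPoint` along a sequence tending to the real
point `t`. -/
theorem edgePoint_mem_frontier (hle : μ ≤ volume) (ha : a ∈ μ.support) (hb : b ∈ μ.support)
    (hc : μ (Icc a b)ᶜ = 0) (hab : 1 < b - a) (ht : t ∈ R μ) :
    edgePoint μ a b t ∈ frontier (liquid μ a b) := by
  have hab' : a ≤ b := by linarith
  have hlim := tendsto_edgePoint (a := a) (b := b) hle hc ht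
  refine ⟨mem_closure_of_tendsto hlim ?_, fun hint => ?_⟩
  · filter_upwards [self_mem_nhdsWithin] with w hw
    exact liquidPoint_mem_liquid hle hc hab' hw
  · obtain ⟨w₀, hw₀, he⟩ := exists_eq_liquidPoint_of_mem_liquid hle hc hab' (interior_subset hint)
    obtain ⟨w, hw⟩ := exists_seq_tendsto (𝓝[upperHalf] (t : ℂ))
    -- The sequence is eventually in the half plane; shifting it by `N` makes every term lie there.
    obtain ⟨N, hN⟩ := eventually_atTop.1 (hw.eventually self_mem_nhdsWithin)
    have hw' : Tendsto (fun n => w (n + N)) atTop (𝓝[upperHalf] (t : ℂ)) :=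
      hw.comp (tendsto_add_atTop_nat N)
    have hne : ∀ z : ℂ, z ∈ nonreal → (t : ℂ) ≠ z := fun z hz h => hz (h ▸ Complex.ofReal_im t)
    have hn := upperHalf_subset_nonreal hw₀
    refine not_tendsto_liquidPoint hle ha hb hc hab hw₀ (hne _ hn)
      (hne _ (star_mem_nonreal hn)) (w := fun n => w (n + N)) (fun n => hN _ (by omega))
      (hw'.mono_right nhdsWithin_le_nhds) ?_
    rw [he]
    exact hlim.comp hw'

theorem continuousAt_liquidPoint (hle : μ ≤ volume) (hc : μ (Icc a b)ᶜ = 0) (hab : a ≤ b)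
    {w : ℂ} (hw : w ∈ upperHalf) : ContinuousAt (liquidPoint μ a b) w := by
  have hn := upperHalf_subset_nonreal hw
  have hE : ContinuousAt (fun w => Complex.exp (cauchy μ a b w)) w :=
    (analyticAt_cauchy hn).cexp.continuousAt
  have hs : ContinuousAt (fun w : ℂ => star w) w := continuous_star.continuousAt
  have hE' : ContinuousAt (fun w => Complex.exp (cauchy μ a b (star w))) w :=
    ContinuousAt.comp (f := fun w : ℂ => star w) (g := fun w => Complex.exp (cauchy μ a b w))
      (analyticAt_cauchy (star_mem_nonreal hn)).cexp.continuousAt hs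
  have hne := sub_ne_zero.2 (exp_cauchy_ne_star hle hc hab hw)
  have hX : ContinuousAt (chiLC μ a b) w :=
    continuousAt_id.add (((continuousAt_id.sub hs).mul (hE'.sub continuousAt_const)).div
      (hE.sub hE') hne)
  have hY : ContinuousAt (etaLC μ a b) w :=
    continuousAt_const.add ((((continuousAt_id.sub hs).mul (hE.sub continuousAt_const)).mul
      (hE'.sub continuousAt_const)).div (hE.sub hE') hne)
  exact tendsto_liquidPoint hX hY

theorem continuousOn_extendedMap (hle : μ ≤ volume) (hc : μ (Icc a b)ᶜ = 0) (hab : a ≤ b) :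
    ContinuousOn (extendedMap μ a b) (halfPlaneWithR μ) := by
  have hlim : ∀ w ∈ halfPlaneWithR μ,
      Tendsto (liquidPoint μ a b) (𝓝[upperHalf] w) (𝓝 (extendedMap μ a b w)) := by
    rintro w (hw | ⟨t, ht, rfl⟩)
    · rw [extendedMap, if_pos hw]
      exact (continuousAt_liquidPoint hle hc hab hw).mono_left nhdsWithin_le_nhds
    · rw [extendedMap, if_neg (by simp [upperHalf]), Complex.ofReal_re]
      exact tendsto_edgePoint hle hc ht
  have hcl : halfPlaneWithR μ ⊆ closure upperHalf := by
    rintro w (hw | ⟨t, ht, rfl⟩)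
    · exact subset_closure hw
    · exact ofReal_mem_closure_upperHalf t
  refine (continuousOn_extendFrom hcl fun w hw => ⟨_, hlim w hw⟩).congr fun w hw => ?_
  exact (extendFrom_eq (hcl hw) (hlim w hw)).symm

theorem eq_edgePoint_of_continuousOn (hle : μ ≤ volume) (hc : μ (Icc a b)ᶜ = 0)
    {G : ℂ → ℝ × ℝ} (hG : ContinuousOn G (halfPlaneWithR μ))
    (hGL : EqOn G (liquidPoint μ a b) upperHalf) (ht : t ∈ R μ) :
    G t = edgePoint μ a b t := by
  have h1 : Tendsto G (𝓝[upperHalf] (t : ℂ)) (𝓝 (G t)) :=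
    (hG t (Or.inr ⟨t, ht, rfl⟩)).mono_left (nhdsWithin_mono _ subset_union_left)
  refine tendsto_nhds_unique (h1.congr' ?_) (tendsto_edgePoint hle hc ht)
  filter_upwards [self_mem_nhdsWithin] with w hw
  exact hGL hw

end Edge

end GTEdge

end

/-! ### Assembly of the theorem. -/

theorem mainTheorem7 (μ : Measure ℝ) [IsProbabilityMeasure μ] (a b : ℝ)
    (hsupp : μ.support ⊆ Icc a b) (hab : 1 < b - a)
    (ha : a ∈ μ.support) (hb : b ∈ μ.support)
    (x : (n : ℕ) → Fin n → ℤ) (hx : ∀ n, StrictAnti (x n))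
    (hlim : Tendsto (fun n => GTEdge.empirical n (x n)) atTop
      (𝓝 (⟨μ, inferInstance⟩ : FiniteMeasure ℝ))) :
    -- `(χ_L, η_L)` is the inverse of the map sending a point of `L` to its root in the half plane
    (BijOn (GTEdge.liquidPoint μ a b) GTEdge.upperHalf (GTEdge.liquid μ a b) ∧
      ∀ w ∈ GTEdge.upperHalf,
        Complex.exp (GTEdge.cauchy μ a b w) ≠ Complex.exp (GTEdge.cauchy μ a b (star w)) ∧
        ∀ p ∈ GTEdge.liquid μ a b,
          GTEdge.fDeriv μ a b p w = 0 ↔ p = GTEdge.liquidPoint μ a b w) ∧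
    -- the extensions of `e^C` and `C'` used in the formulas are the analytic ones
    (GTEdge.IsAnalyticExtension (fun w => Complex.exp (GTEdge.cauchy μ a b w))
        (GTEdge.expC μ a b) μ.support ∧
      GTEdge.IsAnalyticExtension (deriv (GTEdge.cauchy μ a b))
        (GTEdge.derivC μ a b) μ.support ∧
      GTEdge.IsAnalyticExtension (fun w => Complex.exp (GTEdge.cauchy μ a b w))
        (GTEdge.expC μ a b) (volume - μ).support ∧
      GTEdge.IsAnalyticExtension (deriv (GTEdge.cauchy μ a b))
        (GTEdge.derivC μ a b) (volume - μ).support ∧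
      ∀ t ∈ GTEdge.voidSet μ,
        GTEdge.expC μ a b t = Complex.exp (GTEdge.cauchy μ a b t) ∧
        GTEdge.derivC μ a b t = deriv (GTEdge.cauchy μ a b) t) ∧
    -- the edge point for `t` outside `Supp(μ)` or outside `Supp(λ - μ)`
    (∀ t ∈ GTEdge.voidSet μ ∪ GTEdge.satSet μ,
      GTEdge.edgePoint μ a b t ∈ frontier (GTEdge.liquid μ a b) ∧
      GTEdge.expC μ a b t ≠ 0 ∧ GTEdge.derivC μ a b t ≠ 0 ∧
      ((GTEdge.edgePoint μ a b t).1 : ℂ) = t + (GTEdge.expC μ a b t - 1) /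
        (GTEdge.expC μ a b t * GTEdge.derivC μ a b t) ∧
      ((GTEdge.edgePoint μ a b t).2 : ℂ) = 1 + (GTEdge.expC μ a b t - 1) ^ 2 /
        (GTEdge.expC μ a b t * GTEdge.derivC μ a b t)) ∧
    -- the edge point for `t ∈ R₁`, for every admissible interval `(t₂, t₁)`
    (∀ t ∈ GTEdge.R1 μ,
      GTEdge.edgePoint μ a b t ∈ frontier (GTEdge.liquid μ a b) ∧
      ∀ t₂ t₁ : ℝ, GTEdge.IsInterval1 μ t t₂ t₁ →
        GTEdge.edgePoint μ a b t =
          (t, 1 - Real.exp (GTEdge.cauchyOff μ a b t₂ t₁ t) * (t - t₂))) ∧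
    -- the edge point for `t ∈ R₂`, for every admissible interval `(t₂, t₁)`
    (∀ t ∈ GTEdge.R2 μ,
      GTEdge.edgePoint μ a b t ∈ frontier (GTEdge.liquid μ a b) ∧
      ∀ t₂ t₁ : ℝ, GTEdge.IsInterval2 μ t t₂ t₁ →
        GTEdge.edgePoint μ a b t =
          (t - Real.exp (-GTEdge.cauchyOff μ a b t₂ t₁ t) * (t - t₁),
            1 + Real.exp (-GTEdge.cauchyOff μ a b t₂ t₁ t) * (t - t₁))) ∧
    -- convergence to the edge
    (∀ t ∈ GTEdge.R μ, ∀ w : ℕ → ℂ, (∀ n, w n ∈ GTEdge.upperHalf) →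
      Tendsto w atTop (𝓝 (t : ℂ)) →
      Tendsto (fun n => GTEdge.liquidPoint μ a b (w n)) atTop (𝓝 (GTEdge.edgePoint μ a b t))) ∧
    -- the edge curve is the unique continuous extension of `(χ_L, η_L)` to `R`
    (ContinuousOn (GTEdge.extendedMap μ a b) (GTEdge.halfPlaneWithR μ) ∧
      ∀ G : ℂ → ℝ × ℝ, ContinuousOn G (GTEdge.halfPlaneWithR μ) →
        EqOn G (GTEdge.liquidPoint μ a b) GTEdge.upperHalf →
        ∀ t ∈ GTEdge.R μ, G t = GTEdge.edgePoint μ a b t) := by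
  have hle := GTEdge.le_volume_of_tendsto μ x hx hlim
  have hc := GTEdge.measure_compl_Icc_eq_zero hsupp
  have hab' : a ≤ b := by linarith
  refine ⟨⟨⟨fun w hw => GTEdge.liquidPoint_mem_liquid hle hc hab' hw,
      GTEdge.liquidPoint_injOn hle ha hb hc hab,
      fun p hp => GTEdge.exists_eq_liquidPoint_of_mem_liquid hle hc hab' hp⟩,
      fun w hw => ⟨GTEdge.exp_cauchy_ne_star hle hc hab' hw, fun p _ =>
        ⟨GTEdge.eq_liquidPoint_of_fDeriv_eq_zero hle hc hab' hw, ?_⟩⟩⟩,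
    ⟨GTEdge.isAnalyticExtension_expC hle hc subset_union_left,
      GTEdge.isAnalyticExtension_derivC hle hc subset_union_left,
      GTEdge.isAnalyticExtension_expC hle hc subset_union_right,
      GTEdge.isAnalyticExtension_derivC hle hc subset_union_right,
      fun t ht => GTEdge.expC_derivC_of_mem_voidSet ht⟩, ?_, ?_, ?_, ?_, ?_, ?_⟩
  · rintro rfl
    exact GTEdge.fDeriv_liquidPoint hle hc hab' hw
  · intro t ht
    obtain ⟨h1, h2⟩ := GTEdge.expC_ne_zero_and_derivC_ne_zero (a := a) hle hc ht
    obtain ⟨h3, h4⟩ := GTEdge.edgePoint_eq_of_mem_union hle hc hab' ht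
    exact ⟨GTEdge.edgePoint_mem_frontier hle ha hb hc hab (Or.inl (Or.inl ht)), h1, h2, h3, h4⟩
  · intro t ht
    have htR : t ∈ GTEdge.R μ := Or.inl (Or.inr ht)
    refine ⟨GTEdge.edgePoint_mem_frontier hle ha hb hc hab htR, fun t₂ t₁ hI => ?_⟩
    -- The chosen interval and the given one both describe the same limit, so the formula does not
    -- depend on the interval.
    exact tendsto_nhds_unique (GTEdge.tendsto_edgePoint hle hc htR)
      (hI.tendsto_liquidPoint hle hc)
  · intro t ht
    have htR : t ∈ GTEdge.R μ := Or.inr ht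
    refine ⟨GTEdge.edgePoint_mem_frontier hle ha hb hc hab htR, fun t₂ t₁ hI => ?_⟩
    exact tendsto_nhds_unique (GTEdge.tendsto_edgePoint hle hc htR)
      (hI.tendsto_liquidPoint hle hc)
  · intro t ht w hw hwt
    exact (GTEdge.tendsto_edgePoint hle hc ht).comp
      (tendsto_nhdsWithin_iff.2 ⟨hwt, Eventually.of_forall hw⟩)
  · exact GTEdge.continuousOn_extendedMap hle hc hab'
  · intro G hG hGL t ht
    exact GTEdge.eq_edgePoint_of_continuousOn hle hc hG hGL ht
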